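/- Let $\mathbb A_0=\mathbb R$ with $a^*=a$, and let $\mathbb A_{n+1}=\mathbb A_n\times\mathbb A_n$ with $(a,b)(c,d)=(ac-d^*b,\;da+bc^*)$ and $(a,b)^*=(a^*,-b)$; write $\mathbb O=\mathbb A_3$ and $\mathbb S=\mathbb A_4$, with canonical basis $e_0,\dots,e_{15}$ and the usual Euclidean structure. Let $$\mathcal Z(\mathbb S)=\{(u,v)\in\mathbb S\times\mathbb S:\ \|u\|=\|v\|=\sqrt2,\ uv=0\}\subset\mathbb R^{32},$$ with the induced Riemannian metric. Let $G_2=\operatorname{Aut}(\mathbb O)$, viewed as a group of real $8\times 8$ matrices and acting on $\mathbb S=\mathbb O\times\mathbb O$ by $A(a,b)=(Aa,Ab)$, and let $\mathfrak g_2=\operatorname{Der}(\mathbb O)$ be its Lie algebra. For $0\le i<j\le7$ let $E_{ij}\in\mathfrak{so}(8)$ be the matrix with $(E_{ij})_{ij}=-1$, $(E_{ij})_{ji}=1$ and all other entries zero, and put $$\begin{aligned} X_0&=\tfrac12(E_{45}+E_{67}), & X_7&=\tfrac12(E_{16}+E_{25}),\\ X_1&=\tfrac12(E_{46}-E_{57}),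 & X_8&=-\tfrac12(E_{15}-E_{26}),\\ X_2&=\tfrac12(E_{47}+E_{56}), & X_9&=\tfrac12(E_{14}+E_{27}),\\ X_3&=-\tfrac{\sqrt3}6(2E_{23}-E_{45}+E_{67}), & X_{10}&=\tfrac{\sqrt3}6(E_{16}-E_{25}+2E_{34}),\\ X_4&=\tfrac{\sqrt3}6(2E_{13}+E_{46}+E_{57}), & X_{11}&=\tfrac{\sqrt3}6(E_{17}+E_{24}+2E_{35}),\\ X_5&=-\tfrac{\sqrt3}6(2E_{12}-E_{47}+E_{56}), & X_{12}&=-\tfrac{\sqrt3}6(E_{14}-E_{27}-2E_{36}),\\ X_6&=-\tfrac12(E_{17}-E_{24}), & X_{13}&=-\tfrac{\sqrt3}6(E_{15}+E_{26}-2E_{37}). \end{aligned}$$ **Proposition.** $G_2$ and $\mathcal Z(\mathbb S)$ are smooth embedded submanifolds of dimension $14$ (of the space of $8\times8$ matrices and of $\mathbb R^{32}$), and $A\mapsto (A(e_4+e_{13}),A(e_6+e_{15}))$ is a diffeomorphism of $G_2$ onto $\mathcal Z(\mathbb S)$; the metric that it induces on $G_2$ is left-invariant. The matrices $X_0,\dots,X_{13}$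 form a basis of $\mathfrak g_2$, orthonormal with respect to $g_{\mathrm{bi}}(X,Y)=-\operatorname{tr}(XY)$; let $X^0,\dots,X^{13}$ be its dual basis, regarded also as left-invariant $1$-forms on $G_2$. Then $\mathcal Z(\mathbb S)$, equivalently $G_2$ with the induced left-invariant metric, has positive Ricci curvature. Explicitly, on $G_2$, $$\operatorname{Ric}=\frac52\sum_{i=0}^{2}X^i\otimes X^i+\frac{29}{54}\sum_{i=3}^{5}X^i\otimes X^i+\frac56\sum_{i=6}^{13}X^i\otimes X^i .$$ In particular, the metric is not Einstein. -/

import Mathlib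

open scoped ContDiff Matrix

namespace ZeroDivisors

noncomputable section

/-! ### Cayley-Dickson algebras on `ℝ^(2^n)` -/

/-- The component `a` of a vector `x = (a, b)` of `A_(n+1) = A_n × A_n`. -/
def cdFst {n : ℕ} (x : Fin (2 ^ (n + 1)) → ℝ) : Fin (2 ^ n) → ℝ :=
  fun i => x ⟨i, by have h1 := i.isLt; have h2 := pow_succ 2 n; omega⟩

/-- The component `b` of a vector `x = (a, b)` of `A_(n+1) = A_n × A_n`. -/
def cdSnd {n : ℕ} (x : Fin (2 ^ (n + 1)) → ℝ) : Fin (2 ^ n) → ℝ :=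
  fun i => x ⟨2 ^ n + i, by have h1 := i.isLt; have h2 := pow_succ 2 n; omega⟩

/-- The vector `(a, b)` of `A_(n+1) = A_n × A_n`. -/
def cdPair {n : ℕ} (a b : Fin (2 ^ n) → ℝ) : Fin (2 ^ (n + 1)) → ℝ :=
  fun i => if h : (i : ℕ) < 2 ^ n then a ⟨i, h⟩
    else b ⟨i - 2 ^ n, by have h1 := i.isLt; have h2 := pow_succ 2 n; omega⟩

/-- Conjugation: `a* = a` on `A_0 = ℝ`, and `(a, b)* = (a*, -b)`. -/
def cdConj : (n : ℕ) → (Fin (2 ^ n) → ℝ) → (Fin (2 ^ n) → ℝ)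
  | 0, x => x
  | n + 1, x => cdPair (cdConj n (cdFst x)) (-cdSnd x)

/-- Multiplication: `(a, b) (c, d) = (a c - d* b, d a + b c*)`. -/
def cdMul : (n : ℕ) → (Fin (2 ^ n) → ℝ) → (Fin (2 ^ n) → ℝ) → (Fin (2 ^ n) → ℝ)
  | 0, x, y => x * y
  | n + 1, x, y =>
    cdPair
      (cdMul n (cdFst x) (cdFst y) - cdMul n (cdConj n (cdSnd y)) (cdSnd x))
      (cdMul n (cdSnd y) (cdFst x) + cdMul n (cdSnd x) (cdConj n (cdFst y)))

/-- Multiplication of the octonions `𝕆 = A_3`. -/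
def octMul (x y : Fin 8 → ℝ) : Fin 8 → ℝ := cdMul 3 x y

/-- Multiplication of the sedenions `𝕊 = A_4`. -/
def sedMul (x y : Fin 16 → ℝ) : Fin 16 → ℝ := cdMul 4 x y

/-- The canonical basis `e_0, …, e_15` of the sedenions. -/
def e (i : Fin 16) : Fin 16 → ℝ := Pi.single i 1

/-- The Euclidean norm of a sedenion. -/
def sedNorm (x : Fin 16 → ℝ) : ℝ := Real.sqrt (x ⬝ᵥ x)

/-- The Euclidean inner product of `𝕊 × 𝕊 = ℝ^32`. -/
def euclid (p q : (Fin 16 → ℝ) × (Fin 16 → ℝ)) : ℝ := p.1 ⬝ᵥ q.1 + p.2 ⬝ᵥ q.2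

/-- `𝒵(𝕊)`: the normalized pairs of sedenions whose product is zero. -/
def Z : Set ((Fin 16 → ℝ) × (Fin 16 → ℝ)) :=
  {p | sedNorm p.1 = Real.sqrt 2 ∧ sedNorm p.2 = Real.sqrt 2 ∧ sedMul p.1 p.2 = 0}

/-! ### The group `G_2 = Aut(𝕆)`, its Lie algebra, and the orbit map -/

-- The norm only serves to have a differential calculus on the space of matrices.
attribute [local instance] Matrix.normedAddCommGroup Matrix.normedSpace

/-- `G_2 = Aut(𝕆)`, as a set of real `8 × 8` matrices. -/
def G2 : Set (Matrix (Fin 8) (Fin 8) ℝ) :=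
  {A | IsUnit A.det ∧ ∀ x y, A *ᵥ octMul x y = octMul (A *ᵥ x) (A *ᵥ y)}

/-- `𝔤_2 = Der(𝕆)`, as a linear space of real `8 × 8` matrices. -/
def g2 : Set (Matrix (Fin 8) (Fin 8) ℝ) :=
  {D | ∀ x y, D *ᵥ octMul x y = octMul (D *ᵥ x) y + octMul x (D *ᵥ y)}

/-- The diagonal action `A (a, b) = (A a, A b)` of `8 × 8` matrices on `𝕊 = 𝕆 × 𝕆`. -/
def sedAct (A : Matrix (Fin 8) (Fin 8) ℝ) (x : Fin 16 → ℝ) : Fin 16 → ℝ :=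
  cdPair (n := 3) (A *ᵥ cdFst (n := 3) x) (A *ᵥ cdSnd (n := 3) x)

/-- The map `A ↦ A · (e_4 + e_13, e_6 + e_15)`, which is linear in the matrix `A`. -/
def orbitMap (A : Matrix (Fin 8) (Fin 8) ℝ) : (Fin 16 → ℝ) × (Fin 16 → ℝ) :=
  (sedAct A (e 4 + e 13), sedAct A (e 6 + e 15))

/-- The pull-back to `G_2` of the metric of `𝒵(𝕊)` by the orbit map. As the orbit map is linear,
its derivative sends a tangent vector `P` (a matrix) to `orbitMap P` at every base point. -/
def metricG2 (P Q : Matrix (Fin 8) (Fin 8) ℝ) : ℝ := euclid (orbitMap P) (orbitMap Q)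

/-- `g_bi(X, Y) = -tr(X Y)`. -/
def gbi (P Q : Matrix (Fin 8) (Fin 8) ℝ) : ℝ := -(P * Q).trace

/-- The matrix `E_ij` with `(E_ij)_ij = -1` and `(E_ij)_ji = 1`, and zero elsewhere. -/
def E (i j : Fin 8) : Matrix (Fin 8) (Fin 8) ℝ := Matrix.single j i 1 - Matrix.single i j 1

/-- The basis `X_0, …, X_13` of `𝔤_2`. -/
def X : Fin 14 → Matrix (Fin 8) (Fin 8) ℝ :=
  ![(1 / 2 : ℝ) • (E 4 5 + E 6 7),
    (1 / 2 : ℝ) • (E 4 6 - E 5 7),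
    (1 / 2 : ℝ) • (E 4 7 + E 5 6),
    -((Real.sqrt 3 / 6) • ((2 : ℝ) • E 2 3 - E 4 5 + E 6 7)),
    (Real.sqrt 3 / 6) • ((2 : ℝ) • E 1 3 + E 4 6 + E 5 7),
    -((Real.sqrt 3 / 6) • ((2 : ℝ) • E 1 2 - E 4 7 + E 5 6)),
    -((1 / 2 : ℝ) • (E 1 7 - E 2 4)),
    (1 / 2 : ℝ) • (E 1 6 + E 2 5),
    -((1 / 2 : ℝ) • (E 1 5 - E 2 6)),
    (1 / 2 : ℝ) • (E 1 4 + E 2 7),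
    (Real.sqrt 3 / 6) • (E 1 6 - E 2 5 + (2 : ℝ) • E 3 4),
    (Real.sqrt 3 / 6) • (E 1 7 + E 2 4 + (2 : ℝ) • E 3 5),
    -((Real.sqrt 3 / 6) • (E 1 4 - E 2 7 - (2 : ℝ) • E 3 6)),
    -((Real.sqrt 3 / 6) • (E 1 5 + E 2 6 - (2 : ℝ) • E 3 7))]

/-- The left-invariant `1`-form `X^i` on `G_2`, evaluated at the point `A` on the tangent vector
`P`; at the identity it is the `i`-th element of the dual basis of the `gbi`-orthonormal basis
`X_0, …, X_13`. -/
def coframe (i : Fin 14) (A P : Matrix (Fin 8) (Fin 8) ℝ) : ℝ := gbi (X i) (A⁻¹ * P)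

/-! ### Submanifolds of a vector space, and the Ricci tensor in local coordinates -/

/-- `φ : V → M`, with `V` open in `ℝ^n`, is a local parametrization of the set `M`: a smooth
immersion that is a homeomorphism from `V` onto a relatively open subset of `M`. -/
structure IsLocalParam {F : Type*} [NormedAddCommGroup F] [NormedSpace ℝ F] {n : ℕ}
    (M : Set F) (V : Set (Fin n → ℝ)) (φ : (Fin n → ℝ) → F) : Prop where
  isOpen : IsOpen V
  smooth : ContDiffOn ℝ ∞ φ V
  immersion : ∀ x ∈ V, Function.Injective (fderiv ℝ φ x)
  mapsTo : Set.MapsTo φ V M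
  openEmbedding : Topology.IsOpenEmbedding (mapsTo.restrict φ V M)

/-- `M` is a smooth embedded `n`-dimensional submanifold of `F`. -/
def IsSubmanifold {F : Type*} [NormedAddCommGroup F] [NormedSpace ℝ F] (n : ℕ) (M : Set F) :
    Prop :=
  ∀ p ∈ M, ∃ (V : Set (Fin n → ℝ)) (φ : (Fin n → ℝ) → F), IsLocalParam M V φ ∧ p ∈ φ '' V

/-- `θ` restricts to a diffeomorphism between the `n`-dimensional submanifolds `M` and `N`: it is
bijective and turns local parametrizations of `M` into local parametrizations of `N`. -/
def IsDiffeo {F F' : Type*} [NormedAddCommGroup F] [NormedSpace ℝ F]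
    [NormedAddCommGroup F'] [NormedSpace ℝ F'] (n : ℕ) (θ : F → F') (M : Set F) (N : Set F') :
    Prop :=
  Set.BijOn θ M N ∧
    ∀ (V : Set (Fin n → ℝ)) (φ : (Fin n → ℝ) → F), IsLocalParam M V φ → IsLocalParam N V (θ ∘ φ)

/-- The coefficients `g_ij = B(∂_i φ, ∂_j φ)`, in the local coordinates given by `φ`, of the
Riemannian metric that the bilinear form `B` of the ambient space induces on a submanifold. -/
def metricCoeff {F : Type*} [NormedAddCommGroup F] [NormedSpace ℝ F] {n : ℕ}
    (B : F → F → ℝ) (φ : (Fin n → ℝ) → F) (x : Fin n → ℝ) : Matrix (Fin n) (Fin n) ℝ :=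
  Matrix.of fun i j => B (fderiv ℝ φ x (Pi.single i 1)) (fderiv ℝ φ x (Pi.single j 1))

/-- The partial derivative `∂_i f`. -/
def pd {n : ℕ} (i : Fin n) (f : (Fin n → ℝ) → ℝ) (x : Fin n → ℝ) : ℝ :=
  fderiv ℝ f x (Pi.single i 1)

/-- The Christoffel symbol `Γ^k_ij = ½ g^kl (∂_i g_jl + ∂_j g_il - ∂_l g_ij)`. -/
def christoffel {n : ℕ} (g : (Fin n → ℝ) → Matrix (Fin n) (Fin n) ℝ) (k i j : Fin n)
    (x : Fin n → ℝ) : ℝ :=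
  (1 / 2) * ∑ l, (g x)⁻¹ k l *
    (pd i (fun y => g y j l) x + pd j (fun y => g y i l) x - pd l (fun y => g y i j) x)

/-- The components of the curvature tensor of the Levi-Civita connection:
`(∇_i ∇_j - ∇_j ∇_i) ∂_k = R^l_ijk ∂_l`. -/
def riemann {n : ℕ} (g : (Fin n → ℝ) → Matrix (Fin n) (Fin n) ℝ) (l i j k : Fin n)
    (x : Fin n → ℝ) : ℝ :=
  pd i (christoffel g l j k) x - pd j (christoffel g l i k) x
    + ∑ m, (christoffel g l i m x * christoffel g m j k x
      - christoffel g l j m x * christoffel g m i k x)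

/-- The Ricci tensor `Ric(v, w) = v^j w^k R^i_ijk` at the point with coordinates `x`. -/
def ricci {n : ℕ} (g : (Fin n → ℝ) → Matrix (Fin n) (Fin n) ℝ) (x v w : Fin n → ℝ) : ℝ :=
  ∑ j, ∑ k, v j * w k * ∑ i, riemann g i i j k x

/-- The metric induced by `B` on the `n`-dimensional submanifold `M` has positive Ricci
curvature. -/
def HasPositiveRicci {F : Type*} [NormedAddCommGroup F] [NormedSpace ℝ F] (n : ℕ)
    (M : Set F) (B : F → F → ℝ) : Prop :=
  ∀ (V : Set (Fin n → ℝ)) (φ : (Fin n → ℝ) → F), IsLocalParam M V φ →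
    ∀ x ∈ V, ∀ w : Fin n → ℝ, w ≠ 0 → 0 < ricci (metricCoeff B φ) x w w

/-- The metric induced by `B` on the `n`-dimensional submanifold `M` is Einstein: `Ric = c g` for
a constant `c`. -/
def IsEinstein {F : Type*} [NormedAddCommGroup F] [NormedSpace ℝ F] (n : ℕ)
    (M : Set F) (B : F → F → ℝ) : Prop :=
  ∃ c : ℝ, ∀ (V : Set (Fin n → ℝ)) (φ : (Fin n → ℝ) → F), IsLocalParam M V φ →
    ∀ x ∈ V, ∀ v w : Fin n → ℝ,
      ricci (metricCoeff B φ) x v w = c * (v ⬝ᵥ (metricCoeff B φ x *ᵥ w))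

end

end ZeroDivisors

attribute [local instance] Matrix.normedAddCommGroup Matrix.normedSpace

open ZeroDivisors

/-!
The proof rests on one geometric object, the *basic triple*: orthonormal imaginary octonions `a,
b, c` with `ab` orthogonal to `c`. The vectors `1, ab, ac, cb, a, b, c, c(ab)` attached to a basic
triple multiply like `e_0, …, e_7` (`IsBasicTriple.tripleFrame_mul`), so that basic triples
correspond to automorphisms of `𝕆`, an automorphism being recovered from the images of `e_4, e_5,
e_6` (`G2_eq_tripleMatrix`).

Basic triples also describe the zero divisors (`mem_Z_iff`). If `(a, b)(c, d) = 0` with both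
factors of norm `√2`, multiplicativity of the octonion norm makes all four components unit
vectors; solving for `d` leaves `(ac)b̄ = -a(cb̄)`. Thus the associator of `a, c, b̄` has norm
`2`, which is the largest value that unit vectors allow. As the associator only depends on the
imaginary parts, and on the part of one factor orthogonal to another factor, this forces `(a, b,
c)` to be a basic triple, and then `d = c(ab)`. Hence the orbit map is a bijection from `G_2` to
`𝒵(𝕊)`; both it and its inverse `orbitInv` are restrictions of polynomial maps, which gives the
diffeomorphism (`isDiffeo_orbitMap`). The ten equations of a basic triple have independent
differentials at `(e_4, e_5, e_6)`, so the inverse function theorem parametrizes `G_2` near `1`,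
and left translations do the rest (`isSubmanifold_G2`).

For the curvature, a parametrization `φ` of `G_2` carries the `𝔤_2`-valued form `φ⁻¹ dφ`. Its
components `W` in the basis `X` are the left-invariant forms `X^a`. They satisfy the Maurer-Cartan
equation with the structure constants of `X`, and the metric is `∑ t_a W^a ⊗ W^a` with constants
`t_a` equal to `1`, `1/3` or `1/2` (`IsLocalParam.isMaurerCartanCoframe`). For every such coframe
the Christoffel symbols are the gauge transform by `W` of a connection with constant coefficients,
and the coordinate curvature is conjugate by `W` to a constant curvature matrix
(`IsMaurerCartanCoframe.christoffel_eq`, `IsMaurerCartanCoframe.riemann_eq`). This turns the Ricci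
tensor into a quadratic expression in the structure constants (`IsMaurerCartanCoframe.ricci_eq`).
Up to the factors `1/2` and `√3/6` the matrices `X_a` are integral, so its value is a computation
with integers (`sum_ricciFactor`). The result is diagonal in the frame with positive eigenvalues,
and its ratio to the metric is `5/2` on `X_0` but `29/18` on `X_3`, so the metric is not Einstein.
-/

namespace ZeroDivisors

/-! ### The Ricci tensor in a frame with constant structure functions -/

section Frame

variable {n : ℕ}

lemma pd_congr {V : Set (Fin n → ℝ)} (hV : IsOpen V) {f g : (Fin n → ℝ) → ℝ}
    (h : ∀ x ∈ V, f x = g x) (i : Fin n) {x : Fin n → ℝ} (hx : x ∈ V) :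
    pd i f x = pd i g x := by
  have : f =ᶠ[nhds x] g := Filter.eventuallyEq_of_mem (hV.mem_nhds hx) h
  rw [pd, pd, this.fderiv_eq]

lemma pd_mul {f g : (Fin n → ℝ) → ℝ} {x : Fin n → ℝ} (hf : DifferentiableAt ℝ f x)
    (hg : DifferentiableAt ℝ g x) (i : Fin n) :
    pd i (fun y => f y * g y) x = pd i f x * g x + f x * pd i g x := by
  rw [pd, fderiv_fun_mul hf hg]
  simp [pd]; ring

lemma pd_const_mul {f : (Fin n → ℝ) → ℝ} {x : Fin n → ℝ} (hf : DifferentiableAt ℝ f x)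
    (c : ℝ) (i : Fin n) : pd i (fun y => c * f y) x = c * pd i f x := by
  rw [pd, fderiv_const_mul hf]
  simp [pd]

lemma pd_add {f g : (Fin n → ℝ) → ℝ} {x : Fin n → ℝ} (hf : DifferentiableAt ℝ f x)
    (hg : DifferentiableAt ℝ g x) (i : Fin n) :
    pd i (fun y => f y + g y) x = pd i f x + pd i g x := by
  rw [pd, fderiv_fun_add hf hg]
  simp [pd]

lemma pd_sum {ι : Type*} (s : Finset ι) {f : ι → (Fin n → ℝ) → ℝ} {x : Fin n → ℝ}
    (hf : ∀ a ∈ s, DifferentiableAt ℝ (f a) x) (i : Fin n) :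
    pd i (fun y => ∑ a ∈ s, f a y) x = ∑ a ∈ s, pd i (f a) x := by
  rw [pd, fderiv_fun_sum hf]
  simp [pd]

lemma contDiffOn_pd {V : Set (Fin n → ℝ)} (hV : IsOpen V) {f : (Fin n → ℝ) → ℝ}
    (hf : ContDiffOn ℝ ∞ f V) (i : Fin n) : ContDiffOn ℝ ∞ (pd i f) V :=
  (hf.fderiv_of_isOpen hV (by simp)).clm_apply contDiffOn_const

lemma pd_comm {V : Set (Fin n → ℝ)} (hV : IsOpen V) {f : (Fin n → ℝ) → ℝ}
    (hf : ContDiffOn ℝ ∞ f V) (i j : Fin n) {x : Fin n → ℝ} (hx : x ∈ V) :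
    pd i (pd j f) x = pd j (pd i f) x := by
  have hd : DifferentiableAt ℝ (fderiv ℝ f) x :=
    ((hf.fderiv_of_isOpen hV (m := ∞) (by simp)).differentiableOn (by simp)).differentiableAt
      (hV.mem_nhds hx)
  have hs : IsSymmSndFDerivAt ℝ f x :=
    (hf.contDiffAt (hV.mem_nhds hx)).isSymmSndFDerivAt
      (by simpa using WithTop.coe_le_coe.2 (le_top : (2 : ℕ∞) ≤ ⊤))
  have key : ∀ a b : Fin n, pd a (pd b f) x
      = fderiv ℝ (fderiv ℝ f) x (Pi.single a 1) (Pi.single b 1) := by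
    intro a b
    have : pd b f = fun y => fderiv ℝ f y (Pi.single b 1) := rfl
    rw [pd, this, fderiv_clm_apply hd (by fun_prop)]
    simp
  rw [key, key, hs.eq]

/-- The entrywise partial derivative of a matrix-valued function. -/
noncomputable def matPd {m : ℕ} (i : Fin n) (M : (Fin n → ℝ) → Matrix (Fin m) (Fin m) ℝ)
    (x : Fin n → ℝ) : Matrix (Fin m) (Fin m) ℝ :=
  Matrix.of fun a b => pd i (fun y => M y a b) x

lemma matPd_mul {m : ℕ} {M N : (Fin n → ℝ) → Matrix (Fin m) (Fin m) ℝ} {x : Fin n → ℝ}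
    (hM : ∀ a b, DifferentiableAt ℝ (fun y => M y a b) x)
    (hN : ∀ a b, DifferentiableAt ℝ (fun y => N y a b) x) (i : Fin n) :
    matPd i (fun y => M y * N y) x = matPd i M x * N x + M x * matPd i N x := by
  ext a b
  simp only [matPd, Matrix.of_apply, Matrix.mul_apply, Matrix.add_apply]
  rw [pd_sum _ (fun c _ => (hM a c).fun_mul (hN c b)), ← Finset.sum_add_distrib]
  exact Finset.sum_congr rfl fun c _ => pd_mul (hM a c) (hN c b) i

lemma contDiffOn_det {m : ℕ} {V : Set (Fin n → ℝ)}
    {M : (Fin n → ℝ) → Matrix (Fin m) (Fin m) ℝ}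
    (hM : ∀ a b, ContDiffOn ℝ ∞ (fun y => M y a b) V) :
    ContDiffOn ℝ ∞ (fun y => (M y).det) V := by
  simp only [Matrix.det_apply, Units.smul_def, zsmul_eq_mul]
  exact ContDiffOn.sum fun σ _ => contDiffOn_const.mul (contDiffOn_prod fun a _ => hM _ _)

lemma contDiffOn_inv {V : Set (Fin n → ℝ)}
    {M : (Fin n → ℝ) → Matrix (Fin n) (Fin n) ℝ}
    (hM : ∀ a b, ContDiffOn ℝ ∞ (fun y => M y a b) V) (hdet : ∀ x ∈ V, (M x).det ≠ 0)
    (a b : Fin n) : ContDiffOn ℝ ∞ (fun y => (M y)⁻¹ a b) V := by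
  simp only [Matrix.inv_def, Matrix.smul_apply, Matrix.adjugate_apply, Ring.inverse_eq_inv,
    smul_eq_mul]
  refine ((contDiffOn_det hM).inv hdet).mul (contDiffOn_det fun c d => ?_)
  by_cases h : c = b
  · subst h; simpa using contDiffOn_const
  · simpa [Matrix.updateRow_ne h] using hM c d

/-- The connection matrices `(γ_b)^a_c` of the Levi-Civita connection of the metric that is
`diag(t)` in a frame with totally antisymmetric structure constants `f`:
`∇_(e_b) e_c = ∑ a, γ^a_bc e_a`. -/
noncomputable def frameConn (f : Fin n → Fin n → Fin n → ℝ) (t : Fin n → ℝ) (b : Fin n) :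
    Matrix (Fin n) (Fin n) ℝ :=
  Matrix.of fun a c => 1 / 2 * f a b c * (1 + (t c - t b) / t a)

/-- The curvature `R(e_b, e_c) = [γ_b, γ_c] - γ_[e_b, e_c]` in the frame. -/
noncomputable def frameCurv (f : Fin n → Fin n → Fin n → ℝ) (t : Fin n → ℝ) (b c : Fin n) :
    Matrix (Fin n) (Fin n) ℝ :=
  frameConn f t b * frameConn f t c - frameConn f t c * frameConn f t b
    - ∑ a, f a b c • frameConn f t a

/-- An orthogonal coframe `W` on an open set of `ℝ^n`, with entries `W a i = W^a(∂_i)`, that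
satisfies the Maurer-Cartan equation `dW^a = -½ ∑ f_abc W^b ∧ W^c` for totally antisymmetric
constants `f`, and in which the metric is `g = ∑ t_a W^a ⊗ W^a`. -/
structure IsMaurerCartanCoframe (V : Set (Fin n → ℝ)) (f : Fin n → Fin n → Fin n → ℝ)
    (t : Fin n → ℝ) (W : (Fin n → ℝ) → Matrix (Fin n) (Fin n) ℝ)
    (g : (Fin n → ℝ) → Matrix (Fin n) (Fin n) ℝ) : Prop where
  isOpen : IsOpen V
  smooth : ∀ a i, ContDiffOn ℝ ∞ (fun x => W x a i) V
  det_ne_zero : ∀ x ∈ V, (W x).det ≠ 0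
  swap : ∀ a b c, f a c b = -f a b c
  cycl : ∀ a b c, f b c a = f a b c
  ne_zero : ∀ a, t a ≠ 0
  metric : ∀ x ∈ V, g x = (W x)ᵀ * Matrix.diagonal t * W x
  maurerCartan : ∀ x ∈ V, ∀ a i j,
    pd i (fun y => W y a j) x - pd j (fun y => W y a i) x
      = -∑ b, ∑ c, f a b c * W x b i * W x c j

lemma sum_reverse (G : Fin n → Fin n → Fin n → ℝ) :
    ∑ a, ∑ b, ∑ c, G a b c = ∑ a, ∑ b, ∑ c, G c b a := by
  rw [Finset.sum_comm]
  conv_rhs => rw [Finset.sum_comm]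
  exact Finset.sum_congr rfl fun b _ => Finset.sum_comm

lemma sum_rotate (G : Fin n → Fin n → Fin n → ℝ) :
    ∑ a, ∑ b, ∑ c, G a b c = ∑ a, ∑ b, ∑ c, G b c a := by
  conv_rhs => rw [Finset.sum_comm]
  exact Finset.sum_congr rfl fun b _ => Finset.sum_comm

namespace IsMaurerCartanCoframe

variable {V : Set (Fin n → ℝ)} {f : Fin n → Fin n → Fin n → ℝ} {t : Fin n → ℝ}
  {W g : (Fin n → ℝ) → Matrix (Fin n) (Fin n) ℝ}

/-- The connection form `A_i = ∑ b, W^b(∂_i) γ_b` in the frame. -/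
noncomputable def connForm (f : Fin n → Fin n → Fin n → ℝ) (t : Fin n → ℝ)
    (W : (Fin n → ℝ) → Matrix (Fin n) (Fin n) ℝ) (i : Fin n) (x : Fin n → ℝ) :
    Matrix (Fin n) (Fin n) ℝ :=
  ∑ b, W x b i • frameConn f t b

/-- The Christoffel symbols as matrices `(Γ_i)^k_j`: the gauge transform
`W⁻¹ (∂_i W + A_i W)` of the connection form. -/
noncomputable def gauge (f : Fin n → Fin n → Fin n → ℝ) (t : Fin n → ℝ)
    (W : (Fin n → ℝ) → Matrix (Fin n) (Fin n) ℝ) (i : Fin n) (x : Fin n → ℝ) :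
    Matrix (Fin n) (Fin n) ℝ :=
  (W x)⁻¹ * (matPd i W x + connForm f t W i x * W x)

lemma connForm_apply (i : Fin n) (x : Fin n → ℝ) (a c : Fin n) :
    connForm f t W i x a c = ∑ b, W x b i * frameConn f t b a c := by
  simp [connForm, Matrix.sum_apply]

variable (h : IsMaurerCartanCoframe V f t W g)
include h

lemma diff {x : Fin n → ℝ} (hx : x ∈ V) (a i : Fin n) :
    DifferentiableAt ℝ (fun y => W y a i) x :=
  ((h.smooth a i).differentiableOn (by simp)).differentiableAt (h.isOpen.mem_nhds hx)

lemma isUnit_det {x : Fin n → ℝ} (hx : x ∈ V) : IsUnit (W x).det :=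
  (h.det_ne_zero x hx).isUnit

/-- The Koszul formula in the coframe. -/
lemma koszul {x : Fin n → ℝ} (hx : x ∈ V) (i j l : Fin n) :
    (1 / 2) * (pd i (fun y => g y j l) x + pd j (fun y => g y i l) x
      - pd l (fun y => g y i j) x)
      = ((W x)ᵀ * Matrix.diagonal t * (matPd i W x + connForm f t W i x * W x)) l j := by
  have hg : ∀ k p q, pd k (fun y => g y p q) x = ∑ a, t a *
      (pd k (fun y => W y a p) x * W x a q + W x a p * pd k (fun y => W y a q) x) := by
    intro k p q
    have h1 : ∀ y ∈ V, g y p q = ∑ a, t a * (W y a p * W y a q) := by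
      intro y hy
      rw [h.metric y hy, Matrix.mul_apply]
      simp only [Matrix.mul_diagonal, Matrix.transpose_apply]
      exact Finset.sum_congr rfl fun a _ => by ring
    rw [pd_congr h.isOpen h1 k hx,
      pd_sum _ (fun a _ => ((h.diff hx a p).fun_mul (h.diff hx a q)).const_mul _)]
    refine Finset.sum_congr rfl fun a _ => ?_
    rw [pd_const_mul ((h.diff hx a p).fun_mul (h.diff hx a q)),
      pd_mul (h.diff hx a p) (h.diff hx a q)]
  have mc : ∀ p q r, ∑ a, t a * W x a r *
      (pd p (fun y => W y a q) x - pd q (fun y => W y a p) x)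
      = ∑ a, ∑ b, ∑ c, -(t a * W x a r * (f a b c * W x b p * W x c q)) := by
    intro p q r
    simp only [h.maurerCartan x hx, Finset.mul_sum, mul_neg, Finset.sum_neg_distrib]
  -- The three exterior derivatives in the Koszul formula, with the summation indices renamed so
  -- that the products of the entries of `W` agree.
  have e1 := mc i j l
  have e2 := mc i l j
  have e3 := mc j l i
  rw [sum_reverse] at e2
  rw [sum_rotate] at e3
  have e4 : ((W x)ᵀ * Matrix.diagonal t * (matPd i W x + connForm f t W i x * W x)) l j
      = ∑ a, t a * W x a l * pd i (fun y => W y a j) x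
        + ∑ a, ∑ b, ∑ c, 1 / 2 * (W x a l * (f a b c * (t a + t c - t b) * W x b i * W x c j)) := by
    rw [Matrix.mul_apply, ← Finset.sum_add_distrib]
    refine Finset.sum_congr rfl fun a _ => ?_
    simp only [Matrix.mul_diagonal, Matrix.transpose_apply]
    simp only [Matrix.add_apply, Matrix.mul_apply, connForm_apply, matPd, frameConn,
      Matrix.of_apply]
    rw [mul_add, Finset.sum_comm (γ := Fin n)]
    congr 1
    · ring
    · rw [Finset.mul_sum]
      refine Finset.sum_congr rfl fun c _ => ?_
      rw [Finset.sum_mul, Finset.mul_sum]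
      refine Finset.sum_congr rfl fun b _ => ?_
      have := h.ne_zero a
      field_simp
      ring
  have e5 : ∑ a, ∑ b, ∑ c, 1 / 2 * (W x a l * (f a b c * (t a + t c - t b) * W x b i * W x c j))
      = 1 / 2 * (-(∑ a, ∑ b, ∑ c, -(t a * W x a l * (f a b c * W x b i * W x c j)))
        + (∑ a, ∑ b, ∑ c, -(t c * W x c j * (f c b a * W x b i * W x a l)))
        + (∑ a, ∑ b, ∑ c, -(t b * W x b i * (f b c a * W x c j * W x a l)))) := by
    simp only [← Finset.sum_neg_distrib, ← Finset.sum_add_distrib, Finset.mul_sum]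
    refine Finset.sum_congr rfl fun a _ => Finset.sum_congr rfl fun b _ =>
      Finset.sum_congr rfl fun c _ => ?_
    rw [h.cycl a b c, h.swap c a b, h.cycl b c a, h.cycl a b c]
    ring
  rw [e4, e5, ← e1, ← e2, ← e3, hg, hg, hg]
  simp only [← Finset.sum_neg_distrib, ← Finset.sum_add_distrib, ← Finset.sum_sub_distrib,
    Finset.mul_sum]
  refine Finset.sum_congr rfl fun a _ => ?_
  ring

lemma metric_isUnit_det {x : Fin n → ℝ} (hx : x ∈ V) : IsUnit (g x).det := by
  rw [h.metric x hx, Matrix.det_mul, Matrix.det_mul, Matrix.det_transpose, Matrix.det_diagonal]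
  exact ((h.isUnit_det hx).mul (Finset.prod_ne_zero_iff.2 fun a _ => h.ne_zero a).isUnit).mul
    (h.isUnit_det hx)

/-- The Christoffel symbols are the gauge transform by `W` of the connection form of the frame. -/
lemma christoffel_eq {x : Fin n → ℝ} (hx : x ∈ V) (k i j : Fin n) :
    christoffel g k i j x = gauge f t W i x k j := by
  have e : (W x)ᵀ * Matrix.diagonal t * (matPd i W x + connForm f t W i x * W x)
      = g x * gauge f t W i x := by
    rw [h.metric x hx, gauge, Matrix.mul_assoc _ (W x),
      Matrix.mul_nonsing_inv_cancel_left _ _ (h.isUnit_det hx)]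
  have : christoffel g k i j x = ((g x)⁻¹ * (g x * gauge f t W i x)) k j := by
    rw [Matrix.mul_apply, christoffel, Finset.mul_sum]
    refine Finset.sum_congr rfl fun l _ => ?_
    rw [← e, ← h.koszul hx i j l]
    ring
  rw [this, Matrix.nonsing_inv_mul_cancel_left _ _ (h.metric_isUnit_det hx)]

lemma smooth_connForm (i a c : Fin n) :
    ContDiffOn ℝ ∞ (fun x => connForm f t W i x a c) V := by
  simp only [connForm_apply]
  exact ContDiffOn.sum fun b _ => (h.smooth b i).mul contDiffOn_const

lemma smooth_matPd (i a c : Fin n) : ContDiffOn ℝ ∞ (fun x => matPd i W x a c) V :=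
  contDiffOn_pd h.isOpen (h.smooth a c) i

lemma smooth_gauge (i a c : Fin n) :
    ContDiffOn ℝ ∞ (fun x => gauge f t W i x a c) V := by
  simp only [gauge, Matrix.mul_apply, Matrix.add_apply]
  exact ContDiffOn.sum fun b _ => (contDiffOn_inv h.smooth h.det_ne_zero a b).mul
    ((h.smooth_matPd i b c).add
      (ContDiffOn.sum fun d _ => (h.smooth_connForm i b d).mul (h.smooth d c)))

lemma mul_gauge {x : Fin n → ℝ} (hx : x ∈ V) (i : Fin n) :
    W x * gauge f t W i x = matPd i W x + connForm f t W i x * W x := by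
  rw [gauge, Matrix.mul_nonsing_inv_cancel_left _ _ (h.isUnit_det hx)]

/-- The derivative of `W Γ_j = ∂_j W + A_j W`. -/
lemma mul_matPd_gauge {x : Fin n → ℝ} (hx : x ∈ V) (i j : Fin n) :
    W x * matPd i (gauge f t W j) x = matPd i (matPd j W) x + matPd i (connForm f t W j) x * W x
      + connForm f t W j x * matPd i W x - matPd i W x * gauge f t W j x := by
  have dd : ∀ {F : (Fin n → ℝ) → Matrix (Fin n) (Fin n) ℝ},
      (∀ a b, ContDiffOn ℝ ∞ (fun y => F y a b) V) →
      ∀ a b, DifferentiableAt ℝ (fun y => F y a b) x := fun hF a b =>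
    ((hF a b).differentiableOn (by simp)).differentiableAt (h.isOpen.mem_nhds hx)
  have dA := dd (h.smooth_connForm j)
  have e1 := matPd_mul (dd h.smooth) (dd (h.smooth_gauge j)) i
  have e2 := matPd_mul dA (dd h.smooth) i
  have e3 : matPd i (fun y => W y * gauge f t W j y) x
      = matPd i (matPd j W) x + matPd i (fun y => connForm f t W j y * W y) x := by
    ext a b
    refine Eq.trans ?_ (pd_add (g := fun y => (connForm f t W j y * W y) a b)
      (dd (h.smooth_matPd j) a b) ?_ i)
    · refine pd_congr h.isOpen (fun y hy => ?_) i hx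
      exact congrFun (congrFun (h.mul_gauge hy j) a) b
    · simp only [Matrix.mul_apply]
      exact DifferentiableAt.fun_sum fun c _ => (dA a c).fun_mul (dd h.smooth c b)
  rw [e1, e2] at e3
  rw [eq_sub_iff_add_eq', e3, add_assoc]

lemma matPd_matPd_comm {x : Fin n → ℝ} (hx : x ∈ V) (i j : Fin n) :
    matPd i (matPd j W) x = matPd j (matPd i W) x := by
  ext a b
  exact pd_comm h.isOpen (h.smooth a b) i j hx

/-- `∂_i A_j - ∂_j A_i + [A_i, A_j]` is the curvature in the frame. -/
lemma curvature_connForm {x : Fin n → ℝ} (hx : x ∈ V) (i j : Fin n) :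
    matPd i (connForm f t W j) x - matPd j (connForm f t W i) x
      + (connForm f t W i x * connForm f t W j x - connForm f t W j x * connForm f t W i x)
      = ∑ b, ∑ c, (W x b i * W x c j) • frameCurv f t b c := by
  have e1 : ∀ p q, matPd p (connForm f t W q) x
      = ∑ a, pd p (fun y => W y a q) x • frameConn f t a := by
    intro p q
    ext a c
    simp only [matPd, Matrix.of_apply, connForm_apply, Matrix.sum_apply, Matrix.smul_apply,
      smul_eq_mul]
    rw [pd_sum _ fun b _ => (h.diff hx b q).mul_const _]
    refine Finset.sum_congr rfl fun b _ => ?_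
    have := pd_const_mul (h.diff hx b q) (frameConn f t b a c) p
    simpa only [mul_comm] using this
  have e2 : matPd i (connForm f t W j) x - matPd j (connForm f t W i) x
      = -∑ b, ∑ c, (W x b i * W x c j) • ∑ a, f a b c • frameConn f t a := by
    rw [e1, e1, ← Finset.sum_sub_distrib]
    simp only [← sub_smul, h.maurerCartan x hx, neg_smul, Finset.sum_smul, Finset.smul_sum,
      Finset.sum_neg_distrib, smul_smul]
    rw [Finset.sum_comm]
    congr 1
    refine Finset.sum_congr rfl fun b _ => ?_
    rw [Finset.sum_comm]
    exact Finset.sum_congr rfl fun c _ => Finset.sum_congr rfl fun a _ => by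
      congr 1; ring
  have e3 : ∀ p q, connForm f t W p x * connForm f t W q x
      = ∑ b, ∑ c, (W x b p * W x c q) • (frameConn f t b * frameConn f t c) := by
    intro p q
    simp only [connForm, Finset.sum_mul, Finset.mul_sum, Matrix.smul_mul, Matrix.mul_smul,
      smul_smul]
    rw [Finset.sum_comm]
    exact Finset.sum_congr rfl fun b _ => Finset.sum_congr rfl fun c _ => by
      congr 1; ring
  rw [e2, e3 i j, e3 j i, Finset.sum_comm (f := fun b c =>
    (W x b j * W x c i) • (frameConn f t b * frameConn f t c))]
  simp only [← Finset.sum_neg_distrib, ← Finset.sum_add_distrib, ← Finset.sum_sub_distrib]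
  refine Finset.sum_congr rfl fun b _ => Finset.sum_congr rfl fun c _ => ?_
  rw [frameCurv, mul_comm (W x c j)]
  module

/-- The coordinate curvature is the conjugate by `W` of the curvature in the frame. -/
lemma riemann_eq {x : Fin n → ℝ} (hx : x ∈ V) (l i j k : Fin n) :
    riemann g l i j k x
      = ((W x)⁻¹ * ((∑ b, ∑ c, (W x b i * W x c j) • frameCurv f t b c) * W x)) l k := by
  set G := fun i => gauge f t W i x with hG
  have e1 : riemann g l i j k x = (matPd i (gauge f t W j) x - matPd j (gauge f t W i) x
      + (G i * G j - G j * G i)) l k := by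
    simp only [riemann, Matrix.add_apply, Matrix.sub_apply, Matrix.mul_apply, matPd,
      Matrix.of_apply, h.christoffel_eq hx, hG, ← Finset.sum_sub_distrib]
    rw [pd_congr h.isOpen (fun y hy => h.christoffel_eq hy l j k) i hx,
      pd_congr h.isOpen (fun y hy => h.christoffel_eq hy l i k) j hx]
  have e2 : W x * (matPd i (gauge f t W j) x - matPd j (gauge f t W i) x
      + (G i * G j - G j * G i))
      = (∑ b, ∑ c, (W x b i * W x c j) • frameCurv f t b c) * W x := by
    rw [← h.curvature_connForm hx i j, mul_add, mul_sub, h.mul_matPd_gauge hx,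
      h.mul_matPd_gauge hx, h.matPd_matPd_comm hx i j]
    have gi : matPd i W x = W x * G i - connForm f t W i x * W x :=
      eq_sub_of_add_eq (h.mul_gauge hx i).symm
    have gj : matPd j W x = W x * G j - connForm f t W j x * W x :=
      eq_sub_of_add_eq (h.mul_gauge hx j).symm
    rw [gi, gj]
    noncomm_ring
  rw [e1, ← e2, Matrix.nonsing_inv_mul_cancel_left _ _ (h.isUnit_det hx)]

/-- The Ricci tensor at a point, expressed by its values on the frame. -/
theorem ricci_eq {x : Fin n → ℝ} (hx : x ∈ V) (v w : Fin n → ℝ) :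
    ricci g x v w
      = ∑ c, ∑ d, (W x *ᵥ v) c * (W x *ᵥ w) d * ∑ b, frameCurv f t b c b d := by
  have e1 : ∀ j k, ∑ i, riemann g i i j k x
      = ∑ c, ∑ d, W x c j * W x d k * ∑ b, frameCurv f t b c b d := by
    intro j k
    have : ∀ i, riemann g i i j k x = ∑ p, ∑ b, ∑ c, ∑ d,
        ((W x)⁻¹ i p * W x b i) * (W x c j * (frameCurv f t b c p d * W x d k)) := by
      intro i
      rw [h.riemann_eq hx, Matrix.mul_apply]
      refine Finset.sum_congr rfl fun p _ => ?_
      simp only [Finset.sum_mul, Matrix.sum_apply, Matrix.smul_apply,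
        smul_eq_mul, Matrix.mul_apply, Finset.mul_sum]
      rw [Finset.sum_comm]
      refine Finset.sum_congr rfl fun b _ => ?_
      rw [Finset.sum_comm]
      exact Finset.sum_congr rfl fun c _ => Finset.sum_congr rfl fun d _ => by ring
    simp only [this]
    have inv : ∀ p b, ∑ i, (W x)⁻¹ i p * W x b i = if b = p then 1 else 0 := by
      intro p b
      have := congrFun (congrFun (Matrix.mul_nonsing_inv (W x) (h.isUnit_det hx)) b) p
      rw [Matrix.mul_apply, Matrix.one_apply] at this
      rw [← this]
      exact Finset.sum_congr rfl fun i _ => mul_comm _ _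
    have : ∀ p b, ∑ i, ∑ c, ∑ d,
        ((W x)⁻¹ i p * W x b i) * (W x c j * (frameCurv f t b c p d * W x d k))
        = if b = p then ∑ c, ∑ d, W x c j * (frameCurv f t b c p d * W x d k) else 0 := by
      intro p b
      simp only [← Finset.mul_sum]
      rw [← Finset.sum_mul, inv]
      split_ifs <;> simp
    rw [Finset.sum_comm]
    have e : ∀ p, ∑ i, ∑ b, ∑ c, ∑ d,
        ((W x)⁻¹ i p * W x b i) * (W x c j * (frameCurv f t b c p d * W x d k))
        = ∑ c, ∑ d, W x c j * (frameCurv f t p c p d * W x d k) := by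
      intro p
      rw [Finset.sum_comm]
      simp only [this]
      simp
    simp only [e]
    rw [Finset.sum_comm]
    refine Finset.sum_congr rfl fun c _ => ?_
    rw [Finset.sum_comm]
    refine Finset.sum_congr rfl fun d _ => ?_
    rw [Finset.mul_sum]
    exact Finset.sum_congr rfl fun b _ => by ring
  have e2 : ∀ c d, (W x *ᵥ v) c * (W x *ᵥ w) d * ∑ b, frameCurv f t b c b d
      = ∑ j, ∑ k, v j * w k * (W x c j * W x d k * ∑ b, frameCurv f t b c b d) := by
    intro c d
    rw [Matrix.mulVec, Matrix.mulVec, dotProduct, dotProduct, Finset.sum_mul_sum, Finset.sum_mul]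
    simp only [Finset.sum_mul (Finset.univ (α := Fin n))]
    exact Finset.sum_congr rfl fun j _ => Finset.sum_congr rfl fun k _ => by ring
  have e3 : ∀ G : Fin n → Fin n → Fin n → Fin n → ℝ,
      ∑ j, ∑ k, ∑ c, ∑ d, G j k c d = ∑ c, ∑ d, ∑ j, ∑ k, G j k c d := by
    intro G
    calc _ = ∑ j, ∑ c, ∑ k, ∑ d, G j k c d := Finset.sum_congr rfl fun _ _ => Finset.sum_comm
      _ = ∑ c, ∑ j, ∑ k, ∑ d, G j k c d := Finset.sum_comm
      _ = ∑ c, ∑ j, ∑ d, ∑ k, G j k c d := Finset.sum_congr rfl fun _ _ =>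
        Finset.sum_congr rfl fun _ _ => Finset.sum_comm
      _ = _ := Finset.sum_congr rfl fun _ _ => Finset.sum_comm
  simp only [ricci, e1, e2]
  rw [← e3]
  simp only [Finset.mul_sum]

end IsMaurerCartanCoframe
end Frame

/-! ### Octonion identities -/

/-- The multiplication table of the octonions in the basis `e_0, …, e_7`. -/
lemma octMul_eq (x y : Fin 8 → ℝ) : octMul x y =
    ![x 0 * y 0 - x 1 * y 1 - x 2 * y 2 - x 3 * y 3 - x 4 * y 4 - x 5 * y 5 - x 6 * y 6 - x 7 * y 7,
      x 0 * y 1 + x 1 * y 0 + x 2 * y 3 - x 3 * y 2 + x 4 * y 5 - x 5 * y 4 - x 6 * y 7 + x 7 * y 6,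
      x 0 * y 2 - x 1 * y 3 + x 2 * y 0 + x 3 * y 1 + x 4 * y 6 + x 5 * y 7 - x 6 * y 4 - x 7 * y 5,
      x 0 * y 3 + x 1 * y 2 - x 2 * y 1 + x 3 * y 0 + x 4 * y 7 - x 5 * y 6 + x 6 * y 5 - x 7 * y 4,
      x 0 * y 4 - x 1 * y 5 - x 2 * y 6 - x 3 * y 7 + x 4 * y 0 + x 5 * y 1 + x 6 * y 2 + x 7 * y 3,
      x 0 * y 5 + x 1 * y 4 - x 2 * y 7 + x 3 * y 6 - x 4 * y 1 + x 5 * y 0 - x 6 * y 3 + x 7 * y 2,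
      x 0 * y 6 + x 1 * y 7 + x 2 * y 4 - x 3 * y 5 - x 4 * y 2 + x 5 * y 3 + x 6 * y 0 - x 7 * y 1,
      x 0 * y 7 - x 1 * y 6 + x 2 * y 5 + x 3 * y 4 - x 4 * y 3 - x 5 * y 2 + x 6 * y 1 + x 7 * y 0]
    := by
  funext i
  fin_cases i <;> simp [octMul, cdMul, cdPair, cdFst, cdSnd, cdConj] <;> ring

local infixl:70 " ⋆ " => octMul

lemma dot_eq (x y : Fin 8 → ℝ) : x ⬝ᵥ y = x 0 * y 0 + x 1 * y 1 + x 2 * y 2 + x 3 * y 3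
    + x 4 * y 4 + x 5 * y 5 + x 6 * y 6 + x 7 * y 7 := by
  simp [dotProduct, Fin.sum_univ_succ]; ring

lemma dot_self_nonneg {n : ℕ} (x : Fin n → ℝ) : 0 ≤ x ⬝ᵥ x :=
  Finset.sum_nonneg fun i _ => mul_self_nonneg (x i)

/-- Octonion multiplication as a bilinear map. -/
noncomputable def octBilin : (Fin 8 → ℝ) →ₗ[ℝ] (Fin 8 → ℝ) →ₗ[ℝ] (Fin 8 → ℝ) :=
  LinearMap.mk₂ ℝ octMul
    (fun x y z => by
      funext i; simp only [octMul_eq]; fin_cases i <;> simp <;> ring)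
    (fun c x y => by
      funext i; simp only [octMul_eq]; fin_cases i <;> simp <;> ring)
    (fun x y z => by
      funext i; simp only [octMul_eq]; fin_cases i <;> simp <;> ring)
    (fun c x y => by
      funext i; simp only [octMul_eq]; fin_cases i <;> simp <;> ring)

lemma octBilin_apply (x y : Fin 8 → ℝ) : octBilin x y = x ⋆ y := rfl

lemma octMul_add (x y z : Fin 8 → ℝ) : x ⋆ (y + z) = x ⋆ y + x ⋆ z := (octBilin x).map_add y z
lemma add_octMul (x y z : Fin 8 → ℝ) : (x + y) ⋆ z = x ⋆ z + y ⋆ z := octBilin.map_add₂ x y z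
lemma octMul_sub (x y z : Fin 8 → ℝ) : x ⋆ (y - z) = x ⋆ y - x ⋆ z := (octBilin x).map_sub y z
lemma sub_octMul (x y z : Fin 8 → ℝ) : (x - y) ⋆ z = x ⋆ z - y ⋆ z := octBilin.map_sub₂ x y z
lemma octMul_neg (x y : Fin 8 → ℝ) : x ⋆ (-y) = -(x ⋆ y) := (octBilin x).map_neg y
lemma neg_octMul (x y : Fin 8 → ℝ) : (-x) ⋆ y = -(x ⋆ y) := octBilin.map_neg₂ x y
lemma octMul_smul (r : ℝ) (x y : Fin 8 → ℝ) : x ⋆ (r • y) = r • (x ⋆ y) :=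
  (octBilin x).map_smul r y
lemma smul_octMul (r : ℝ) (x y : Fin 8 → ℝ) : (r • x) ⋆ y = r • (x ⋆ y) :=
  octBilin.map_smul₂ r x y
lemma octMul_zero (x : Fin 8 → ℝ) : x ⋆ 0 = 0 := (octBilin x).map_zero
lemma zero_octMul (x : Fin 8 → ℝ) : 0 ⋆ x = 0 := octBilin.map_zero₂ x

/-- The unit of the octonions. -/
noncomputable def octOne : Fin 8 → ℝ := Pi.single 0 1

lemma octOne_zero : octOne 0 = 1 := by simp [octOne]

lemma dot_octOne (x : Fin 8 → ℝ) : x ⬝ᵥ octOne = x 0 := by simp [octOne]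

lemma octOne_dot (x : Fin 8 → ℝ) : octOne ⬝ᵥ x = x 0 := by simp [octOne]

lemma octOne_mul (x : Fin 8 → ℝ) : octOne ⋆ x = x := by
  funext i; rw [octMul_eq]; fin_cases i <;> simp [octOne]

lemma mul_octOne (x : Fin 8 → ℝ) : x ⋆ octOne = x := by
  funext i; rw [octMul_eq]; fin_cases i <;> simp [octOne]

/-- The quadratic equation `x² = 2 Re(x) x - |x|²`. -/
lemma octMul_self (x : Fin 8 → ℝ) : x ⋆ x = (2 * x 0) • x - (x ⬝ᵥ x) • octOne := by
  funext i; rw [octMul_eq, dot_eq]; fin_cases i <;> simp [octOne] <;> ring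

/-- The norm of the octonions is multiplicative. -/
lemma octMul_dot_octMul_left (x y z : Fin 8 → ℝ) :
    (x ⋆ y) ⬝ᵥ (x ⋆ z) = (x ⬝ᵥ x) * (y ⬝ᵥ z) := by
  simp only [dot_eq, octMul_eq, Matrix.cons_val]; ring

lemma octMul_zero_eq {x : Fin 8 → ℝ} (hx : x 0 = 0) (y : Fin 8 → ℝ) :
    (x ⋆ y) 0 = -(x ⬝ᵥ y) := by
  simp only [dot_eq, octMul_eq, Matrix.cons_val, hx]; ring

lemma octMul_zero_eq' (x : Fin 8 → ℝ) {y : Fin 8 → ℝ} (hy : y 0 = 0) :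
    (x ⋆ y) 0 = -(x ⬝ᵥ y) := by
  simp only [dot_eq, octMul_eq, Matrix.cons_val, hy]; ring

lemma octMul_dot {x : Fin 8 → ℝ} (hx : x 0 = 0) (y z : Fin 8 → ℝ) :
    (x ⋆ y) ⬝ᵥ z = -(y ⬝ᵥ (x ⋆ z)) := by
  simp only [dot_eq, octMul_eq, Matrix.cons_val, hx]; ring

lemma left_alt {x : Fin 8 → ℝ} (hx : x 0 = 0) (y : Fin 8 → ℝ) :
    x ⋆ (x ⋆ y) = -((x ⬝ᵥ x) • y) := by
  funext i; simp only [octMul_eq, dot_eq, Matrix.cons_val, hx]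
  fin_cases i <;> simp <;> ring

lemma right_alt {x : Fin 8 → ℝ} (hx : x 0 = 0) (y : Fin 8 → ℝ) :
    (y ⋆ x) ⋆ x = -((x ⬝ᵥ x) • y) := by
  funext i; simp only [octMul_eq, dot_eq, Matrix.cons_val, hx]
  fin_cases i <;> simp <;> ring

/-- Orthogonal imaginary octonions anticommute. -/
lemma anticomm {x y : Fin 8 → ℝ} (hx : x 0 = 0) (hy : y 0 = 0) (h : x ⬝ᵥ y = 0) :
    x ⋆ y = -(y ⋆ x) := by
  rw [dot_eq, hx, hy] at h
  funext i; simp only [octMul_eq, Pi.neg_apply]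
  fin_cases i <;> simp [hx, hy] <;> linarith

/-- The polarization of `left_alt`. -/
lemma left_skew {x y : Fin 8 → ℝ} (hx : x 0 = 0) (hy : y 0 = 0) (h : x ⬝ᵥ y = 0)
    (z : Fin 8 → ℝ) : x ⋆ (y ⋆ z) = -(y ⋆ (x ⋆ z)) := by
  have h1 := left_alt (x := x + y) (by simp [hx, hy]) z
  have h2 : (x + y) ⬝ᵥ (x + y) = x ⬝ᵥ x + y ⬝ᵥ y := by
    rw [add_dotProduct, dotProduct_add, dotProduct_add, h, dotProduct_comm y x, h]; ring
  simp only [add_octMul, octMul_add, left_alt hx, left_alt hy, h2] at h1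
  rw [eq_neg_iff_add_eq_zero]
  linear_combination (norm := module) h1

/-- The associator depends only on the imaginary parts. -/
lemma assoc_imag (x y z : Fin 8 → ℝ) :
    (x ⋆ y) ⋆ z - x ⋆ (y ⋆ z) = ((x - x 0 • octOne) ⋆ (y - y 0 • octOne)) ⋆ (z - z 0 • octOne)
      - (x - x 0 • octOne) ⋆ ((y - y 0 • octOne) ⋆ (z - z 0 • octOne)) := by
  simp only [octMul_sub, sub_octMul, octMul_smul, smul_octMul, octOne_mul, mul_octOne]
  module

/-- Orthonormal imaginary octonions `a, b, c` with `ab` orthogonal to `c`. These are the images of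
`(e_4, e_5, e_6)` under the automorphisms of the octonions. -/
structure IsBasicTriple (a b c : Fin 8 → ℝ) : Prop where
  a_imag : a 0 = 0
  b_imag : b 0 = 0
  c_imag : c 0 = 0
  aa : a ⬝ᵥ a = 1
  bb : b ⬝ᵥ b = 1
  cc : c ⬝ᵥ c = 1
  ab : a ⬝ᵥ b = 0
  ac : a ⬝ᵥ c = 0
  bc : b ⬝ᵥ c = 0
  abc : (a ⋆ b) ⬝ᵥ c = 0

/-- The images of `e_0, …, e_7` under the automorphism that sends `(e_4, e_5, e_6)` to
`(a, b, c)`. -/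
noncomputable def tripleFrame (a b c : Fin 8 → ℝ) : Fin 8 → (Fin 8 → ℝ) :=
  ![octOne, a ⋆ b, a ⋆ c, c ⋆ b, a, b, c, c ⋆ (a ⋆ b)]

namespace IsBasicTriple

variable {a b c : Fin 8 → ℝ} (h : IsBasicTriple a b c)
include h

set_option maxHeartbeats 1000000 in
/-- The frame of a basic triple multiplies like the canonical basis of the octonions. -/
lemma tripleFrame_mul (i j : Fin 8) :
    tripleFrame a b c i ⋆ tripleFrame a b c j
      = ∑ k, octMul (Pi.single i 1) (Pi.single j 1) k • tripleFrame a b c k := by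
  obtain ⟨ha, hb, hc, aa, bb, cc, ab, ac, bc, abc⟩ := h
  have sq : ∀ x : Fin 8 → ℝ, x 0 = 0 → x ⬝ᵥ x = 1 → x ⋆ x = -octOne := by
    intro x hx h1; rw [octMul_self, hx, h1]; simp
  have la : ∀ x : Fin 8 → ℝ, x 0 = 0 → x ⬝ᵥ x = 1 → ∀ y, x ⋆ (x ⋆ y) = -y := by
    intro x hx h1 y; rw [left_alt hx, h1, one_smul]
  have ra : ∀ x : Fin 8 → ℝ, x 0 = 0 → x ⬝ᵥ x = 1 → ∀ y, (y ⋆ x) ⋆ x = -y := by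
    intro x hx h1 y; rw [right_alt hx, h1, one_smul]
  have ba : b ⬝ᵥ a = 0 := by rw [dotProduct_comm, ab]
  have ca : c ⬝ᵥ a = 0 := by rw [dotProduct_comm, ac]
  have cb : c ⬝ᵥ b = 0 := by rw [dotProduct_comm, bc]
  -- `p, q, r, s` are the images of `e_1, e_2, e_3, e_7`.
  obtain ⟨p, hp⟩ : ∃ p, p = a ⋆ b := ⟨_, rfl⟩
  obtain ⟨q, hq⟩ : ∃ q, q = a ⋆ c := ⟨_, rfl⟩
  obtain ⟨r, hr⟩ : ∃ r, r = c ⋆ b := ⟨_, rfl⟩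
  obtain ⟨s, hs⟩ : ∃ s, s = c ⋆ p := ⟨_, rfl⟩
  have p0 : p 0 = 0 := by rw [hp, octMul_zero_eq ha, ab, neg_zero]
  have q0 : q 0 = 0 := by rw [hq, octMul_zero_eq ha, ac, neg_zero]
  have r0 : r 0 = 0 := by rw [hr, octMul_zero_eq hc, cb, neg_zero]
  have pc : p ⬝ᵥ c = 0 := by rw [hp, abc]
  have cp : c ⬝ᵥ p = 0 := by rw [dotProduct_comm, pc]
  have s0 : s 0 = 0 := by rw [hs, octMul_zero_eq hc, cp, neg_zero]
  have pp : p ⬝ᵥ p = 1 := by rw [hp, octMul_dot_octMul_left, aa, bb, one_mul]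
  have qq : q ⬝ᵥ q = 1 := by rw [hq, octMul_dot_octMul_left, aa, cc, one_mul]
  have rr : r ⬝ᵥ r = 1 := by rw [hr, octMul_dot_octMul_left, cc, bb, one_mul]
  have ss : s ⬝ᵥ s = 1 := by rw [hs, octMul_dot_octMul_left, cc, pp, one_mul]
  -- products of the generators
  have hba : b ⋆ a = -p := by rw [anticomm hb ha ba, hp]
  have hca : c ⋆ a = -q := by rw [anticomm hc ha ca, hq]
  have hbc : b ⋆ c = -r := by rw [anticomm hb hc bc, hr]
  have hap : a ⋆ p = -b := by rw [hp, la a ha aa]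
  have haq : a ⋆ q = -c := by rw [hq, la a ha aa]
  have hcr : c ⋆ r = -b := by rw [hr, la c hc cc]
  have hcs : c ⋆ s = -p := by rw [hs, la c hc cc]
  have hpb : p ⋆ b = -a := by rw [hp, ra b hb bb]
  have hqc : q ⋆ c = -a := by rw [hq, ra c hc cc]
  have hrb : r ⋆ b = -c := by rw [hr, ra b hb bb]
  have hbp : b ⋆ p = a := by rw [← neg_eq_iff_eq_neg.2 hba, octMul_neg, la b hb bb, neg_neg]
  have hcq : c ⋆ q = a := by rw [← neg_eq_iff_eq_neg.2 hca, octMul_neg, la c hc cc, neg_neg]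
  have hbr : b ⋆ r = c := by rw [← neg_eq_iff_eq_neg.2 hbc, octMul_neg, la b hb bb, neg_neg]
  have hpa : p ⋆ a = b := by rw [← neg_eq_iff_eq_neg.2 hba, neg_octMul, ra a ha aa, neg_neg]
  have hqa : q ⋆ a = c := by rw [← neg_eq_iff_eq_neg.2 hca, neg_octMul, ra a ha aa, neg_neg]
  have hrc : r ⋆ c = b := by rw [← neg_eq_iff_eq_neg.2 hbc, neg_octMul, ra c hc cc, neg_neg]
  have hpc : p ⋆ c = -s := by rw [hs, anticomm p0 hc pc]
  -- A product of imaginary octonions that is imaginary anticommutes.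
  have rev : ∀ x y z : Fin 8 → ℝ, x 0 = 0 → y 0 = 0 → z 0 = 0 → x ⋆ y = z → y ⋆ x = -z := by
    intro x y z hx hy hz e
    have : x ⬝ᵥ y = 0 := by rw [← neg_eq_zero, ← octMul_zero_eq hx, e, hz]
    rw [← e, anticomm hx hy this, neg_neg]
  have perp : ∀ x y z : Fin 8 → ℝ, x 0 = 0 → z 0 = 0 → x ⋆ y = z → x ⬝ᵥ y = 0 := by
    intro x y z hx hz e
    rw [← neg_eq_zero, ← octMul_zero_eq hx, e, hz]
  have nz : ∀ x : Fin 8 → ℝ, x 0 = 0 → (-x) 0 = 0 := by intro x hx; simp [hx]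
  have hsc : s ⋆ c = p := by rw [rev c s (-p) hc s0 (nz p p0) hcs, neg_neg]
  have has : a ⋆ s = r := by rw [hs, left_skew ha hc ac, hap, octMul_neg, neg_neg, hr]
  have hsa : s ⋆ a = -r := rev a s r ha s0 r0 has
  have hpq : p ⋆ q = r := by
    rw [hq, left_skew p0 ha (perp p a b p0 hb hpa), hpc, octMul_neg, neg_neg, has]
  have hqp : q ⋆ p = -r := rev p q r p0 q0 r0 hpq
  have hpr : p ⋆ r = -q := by rw [hr, left_skew p0 hc pc, hpb, octMul_neg, neg_neg, hca]
  have hrp : r ⋆ p = q := by rw [rev p r (-q) p0 r0 (nz q q0) hpr, neg_neg]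
  have hps : p ⋆ s = c := by
    rw [← neg_eq_iff_eq_neg.2 hpc, octMul_neg, la p p0 pp, neg_neg]
  have hsp : s ⋆ p = -c := rev p s c p0 s0 hc hps
  have har : a ⋆ r = -s := by rw [hr, left_skew ha hc ac, ← hp, hs]
  have hra : r ⋆ a = s := by rw [rev a r (-s) ha r0 (nz s s0) har, neg_neg]
  have hbq : b ⋆ q = -s := by rw [hq, left_skew hb ha ba, hbc, octMul_neg, neg_neg, har]
  have hqb : q ⋆ b = s := by rw [rev b q (-s) hb q0 (nz s s0) hbq, neg_neg]
  have hqr : q ⋆ r = p := by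
    rw [hr, left_skew q0 hc (perp q c (-a) q0 (nz a ha) hqc), hqb, hcs, neg_neg]
  have hrq : r ⋆ q = -p := rev q r p q0 r0 p0 hqr
  have hqs : q ⋆ s = -b := by
    rw [hs, left_skew q0 hc (perp q c (-a) q0 (nz a ha) hqc), hqp, octMul_neg, neg_neg, hcr]
  have hsq : s ⋆ q = b := by rw [rev q s (-b) q0 s0 (nz b hb) hqs, neg_neg]
  have hrs : r ⋆ s = -a := by
    rw [hs, left_skew r0 hc (perp r c b r0 hb hrc), hrp, hcq]
  have hsr : s ⋆ r = a := by rw [rev r s (-a) r0 s0 (nz a ha) hrs, neg_neg]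
  have hbs : b ⋆ s = q := by rw [hs, left_skew hb hc bc, hbp, hca, neg_neg]
  have hsb : s ⋆ b = -q := rev b s q hb s0 q0 hbs
  have haa := sq a ha aa
  have hbb := sq b hb bb
  have hcc := sq c hc cc
  have hpp := sq p p0 pp
  have hqq := sq q q0 qq
  have hrr := sq r r0 rr
  have hss := sq s s0 ss
  have hF : tripleFrame a b c = ![octOne, p, q, r, a, b, c, s] := by
    rw [tripleFrame, hs, hp, hq, hr]
  rw [hF]
  have hab := hp.symm
  have hac := hq.symm
  have hcb := hr.symm
  have hcp := hs.symm
  clear hF hp hq hr hs ab ac bc abc ba ca cb pc cp p0 q0 r0 s0 ha hb hc rev perp nz sq la ra aa bb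
    cc pp qq rr ss
  have e8 : ∀ G : Fin 8 → (Fin 8 → ℝ), ∑ k, G k
      = G 0 + G 1 + G 2 + G 3 + G 4 + G 5 + G 6 + G 7 := fun G => by
    simp [Fin.sum_univ_succ]; abel
  rw [e8, octMul_eq (Pi.single i 1)]
  clear e8
  fin_cases i <;> fin_cases j <;> simp [octOne_mul, mul_octOne, *]

end IsBasicTriple

/-! ### The automorphism group of the octonions -/

/-- The linear map that sends `(e_4, e_5, e_6)` to `(a, b, c)` and multiplies accordingly. -/
noncomputable def tripleMatrix (a b c : Fin 8 → ℝ) : Matrix (Fin 8) (Fin 8) ℝ :=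
  Matrix.of fun i j => tripleFrame a b c j i

lemma tripleMatrix_mulVec_single (a b c : Fin 8 → ℝ) (j : Fin 8) :
    tripleMatrix a b c *ᵥ Pi.single j 1 = tripleFrame a b c j := by
  rw [Matrix.mulVec_single_one]; rfl

lemma mulVec_eq_sum_single (A : Matrix (Fin 8) (Fin 8) ℝ) (x : Fin 8 → ℝ) :
    A *ᵥ x = ∑ k, x k • (A *ᵥ Pi.single k 1) := by
  funext i
  simp [Matrix.mulVec, dotProduct, Finset.sum_apply, mul_comm]

/-- A matrix that is multiplicative on the canonical basis is multiplicative. -/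
lemma mulVec_octMul_of_basis {A : Matrix (Fin 8) (Fin 8) ℝ}
    (h : ∀ i j : Fin 8, A *ᵥ (Pi.single i 1 ⋆ Pi.single j 1)
      = (A *ᵥ Pi.single i 1) ⋆ (A *ᵥ Pi.single j 1)) (x y : Fin 8 → ℝ) :
    A *ᵥ (x ⋆ y) = (A *ᵥ x) ⋆ (A *ᵥ y) := by
  have : octBilin.compr₂ A.mulVecLin = octBilin.compl₁₂ A.mulVecLin A.mulVecLin := by
    refine LinearMap.ext_basis (Pi.basisFun ℝ (Fin 8)) (Pi.basisFun ℝ (Fin 8)) fun i j => ?_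
    simpa [octBilin_apply] using h i j
  exact LinearMap.congr_fun₂ this x y

lemma octMul_dot_self (x y : Fin 8 → ℝ) : (x ⋆ y) ⬝ᵥ (x ⋆ y) = (x ⬝ᵥ x) * (y ⬝ᵥ y) :=
  octMul_dot_octMul_left x y y

/-- The octonions have no proper ideal: a unital multiplicative linear map is injective. -/
lemma mem_G2_of_unital {A : Matrix (Fin 8) (Fin 8) ℝ}
    (h : ∀ x y, A *ᵥ (x ⋆ y) = (A *ᵥ x) ⋆ (A *ᵥ y)) (h1 : A *ᵥ octOne = octOne) : A ∈ G2 := by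
  refine ⟨?_, h⟩
  rw [← Matrix.isUnit_iff_isUnit_det, ← Matrix.mulVec_injective_iff_isUnit]
  intro x y hxy
  by_contra hne
  set z := x - y with hz
  have hAz : A *ᵥ z = 0 := by
    rw [hz, Matrix.mulVec_sub, sub_eq_zero]; exact hxy
  have h2 := h z z
  rw [hAz, octMul_zero, octMul_self, Matrix.mulVec_sub, Matrix.mulVec_smul, Matrix.mulVec_smul,
    hAz, h1, smul_zero, zero_sub, neg_eq_zero, smul_eq_zero] at h2
  rcases h2 with h2 | h2
  · exact hne (sub_eq_zero.1 (dotProduct_self_eq_zero.1 h2))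
  · have := congrFun h2 0
    simp [octOne] at this

lemma IsBasicTriple.tripleMatrix_mem {a b c : Fin 8 → ℝ} (h : IsBasicTriple a b c) :
    tripleMatrix a b c ∈ G2 := by
  refine mem_G2_of_unital (mulVec_octMul_of_basis fun i j => ?_) ?_
  · rw [tripleMatrix_mulVec_single, tripleMatrix_mulVec_single, h.tripleFrame_mul,
      mulVec_eq_sum_single]
    simp only [tripleMatrix_mulVec_single]
  · rw [octOne, tripleMatrix_mulVec_single]; rfl

lemma one_mem_G2 : (1 : Matrix (Fin 8) (Fin 8) ℝ) ∈ G2 := ⟨by simp, by simp⟩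

section G2

variable {A : Matrix (Fin 8) (Fin 8) ℝ} (hA : A ∈ G2)
include hA

lemma G2_map_one : A *ᵥ octOne = octOne := by
  have hs : Function.Surjective A.mulVec :=
    Matrix.mulVec_surjective_iff_isUnit.2 ((Matrix.isUnit_iff_isUnit_det A).2 hA.1)
  obtain ⟨y, hy⟩ := hs octOne
  have := hA.2 octOne y
  rw [octOne_mul, hy] at this
  rw [← mul_octOne (A *ᵥ octOne)]
  exact this.symm

lemma G2_injective {x y : Fin 8 → ℝ} (h : A *ᵥ x = A *ᵥ y) : x = y :=
  Matrix.mulVec_injective_iff_isUnit.2 ((Matrix.isUnit_iff_isUnit_det A).2 hA.1) h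

/-- Imaginary octonions are those whose square is a nonpositive multiple of `1`, and the square
determines their norm; so automorphisms preserve both. -/
lemma G2_imag {x : Fin 8 → ℝ} (hx : x 0 = 0) :
    (A *ᵥ x) 0 = 0 ∧ (A *ᵥ x) ⬝ᵥ (A *ᵥ x) = x ⬝ᵥ x := by
  have h := hA.2 x x
  rw [octMul_self, octMul_self, hx, mul_zero, zero_smul, zero_sub, Matrix.mulVec_neg,
    Matrix.mulVec_smul, G2_map_one hA] at h
  set y := A *ᵥ x with hy
  have hy0 : y 0 = 0 := by
    by_contra hne
    -- otherwise `y`, and hence `x`, would be real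
    have e : y = (((y ⬝ᵥ y) - x ⬝ᵥ x) / (2 * y 0)) • octOne := by
      have h' : (2 * y 0) • y = ((y ⬝ᵥ y) - x ⬝ᵥ x) • octOne := by
        rw [sub_smul, sub_eq_add_neg, h]; abel
      rw [div_eq_inv_mul, mul_smul, ← h', smul_smul, inv_mul_cancel₀ (by simpa using hne),
        one_smul]
    have e' : x = (((y ⬝ᵥ y) - x ⬝ᵥ x) / (2 * y 0)) • octOne := by
      refine G2_injective hA ?_
      rw [Matrix.mulVec_smul, G2_map_one hA]
      exact e
    rw [← e] at e'
    exact hne (by rw [← e', hx])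
  refine ⟨hy0, ?_⟩
  have := congrFun h 0
  simp [hy0, octOne] at this
  exact this.symm

lemma G2_apply_zero (x : Fin 8 → ℝ) : (A *ᵥ x) 0 = x 0 := by
  have h := (G2_imag hA (x := x - x 0 • octOne) (by simp [octOne])).1
  rw [Matrix.mulVec_sub, Matrix.mulVec_smul, G2_map_one hA] at h
  simpa [octOne, sub_eq_zero] using h

lemma G2_dot_self (x : Fin 8 → ℝ) : (A *ᵥ x) ⬝ᵥ (A *ᵥ x) = x ⬝ᵥ x := by
  have h := (G2_imag hA (x := x - x 0 • octOne) (by simp [octOne])).2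
  rw [Matrix.mulVec_sub, Matrix.mulVec_smul, G2_map_one hA] at h
  simp only [sub_dotProduct, dotProduct_sub, smul_dotProduct, dotProduct_smul, dot_octOne,
    octOne_dot, G2_apply_zero hA, octOne_zero] at h
  simpa using h

lemma G2_dot (x y : Fin 8 → ℝ) : (A *ᵥ x) ⬝ᵥ (A *ᵥ y) = x ⬝ᵥ y := by
  have h := G2_dot_self hA (x + y)
  simp only [Matrix.mulVec_add, add_dotProduct, dotProduct_add, G2_dot_self hA,
    dotProduct_comm (A *ᵥ y), dotProduct_comm y] at h
  linarith

/-- Automorphisms of the octonions are orthogonal. -/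
lemma G2_transpose_mul : Aᵀ * A = 1 := by
  ext i j
  have h := G2_dot hA (Pi.single i 1) (Pi.single j 1)
  rw [Matrix.mulVec_single_one, Matrix.mulVec_single_one] at h
  rw [Matrix.mul_apply, Matrix.one_apply]
  refine Eq.trans h ?_
  simp [Pi.single_apply, eq_comm]

lemma G2_mul_transpose : A * Aᵀ = 1 := mul_eq_one_comm.1 (G2_transpose_mul hA)

lemma G2_inv : A⁻¹ = Aᵀ := Matrix.inv_eq_left_inv (G2_transpose_mul hA)

lemma G2_inv_mem : A⁻¹ ∈ G2 := by
  have hm : ∀ x, A *ᵥ (A⁻¹ *ᵥ x) = x := fun x => by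
    rw [Matrix.mulVec_mulVec, Matrix.mul_nonsing_inv _ hA.1, Matrix.one_mulVec]
  refine ⟨by rw [Matrix.isUnit_nonsing_inv_det_iff]; exact hA.1, fun x y => ?_⟩
  refine G2_injective hA ?_
  rw [hA.2, hm, hm, hm]

lemma G2_mul_mem {B : Matrix (Fin 8) (Fin 8) ℝ} (hB : B ∈ G2) : A * B ∈ G2 := by
  refine ⟨by rw [Matrix.det_mul]; exact hA.1.mul hB.1, fun x y => ?_⟩
  simp only [← Matrix.mulVec_mulVec]
  rw [hB.2, hA.2]

end G2

/-! ### The zero divisors of the sedenions and the orbit map -/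

lemma IsBasicTriple.map {a b c : Fin 8 → ℝ} (h : IsBasicTriple a b c)
    {A : Matrix (Fin 8) (Fin 8) ℝ} (hA : A ∈ G2) :
    IsBasicTriple (A *ᵥ a) (A *ᵥ b) (A *ᵥ c) where
  a_imag := by rw [G2_apply_zero hA, h.a_imag]
  b_imag := by rw [G2_apply_zero hA, h.b_imag]
  c_imag := by rw [G2_apply_zero hA, h.c_imag]
  aa := by rw [G2_dot hA, h.aa]
  bb := by rw [G2_dot hA, h.bb]
  cc := by rw [G2_dot hA, h.cc]
  ab := by rw [G2_dot hA, h.ab]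
  ac := by rw [G2_dot hA, h.ac]
  bc := by rw [G2_dot hA, h.bc]
  abc := by rw [← hA.2, G2_dot hA, h.abc]

lemma isBasicTriple_single :
    IsBasicTriple (Pi.single 4 1) (Pi.single 5 1) (Pi.single 6 1) where
  a_imag := by simp
  b_imag := by simp
  c_imag := by simp
  aa := by simp
  bb := by simp
  cc := by simp
  ab := by simp
  ac := by simp
  bc := by simp
  abc := by simp [octMul_eq]

lemma tripleFrame_single (j : Fin 8) :
    tripleFrame (Pi.single 4 1) (Pi.single 5 1) (Pi.single 6 1) j = Pi.single j 1 := by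
  funext i
  fin_cases j <;> fin_cases i <;> simp [tripleFrame, octMul_eq, octOne]

/-- An automorphism is determined by the images of `e_4, e_5, e_6`. -/
lemma G2_eq_tripleMatrix {A : Matrix (Fin 8) (Fin 8) ℝ} (hA : A ∈ G2) :
    tripleMatrix (A *ᵥ Pi.single 4 1) (A *ᵥ Pi.single 5 1) (A *ᵥ Pi.single 6 1) = A := by
  have h : ∀ j, tripleFrame (A *ᵥ Pi.single 4 1) (A *ᵥ Pi.single 5 1) (A *ᵥ Pi.single 6 1) j
      = A *ᵥ Pi.single j 1 := by
    intro j
    rw [← tripleFrame_single j]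
    fin_cases j <;> simp only [tripleFrame] <;> simp [hA.2, G2_map_one hA]
  ext i j
  have := congrFun (h j) i
  rw [Matrix.mulVec_single_one A j] at this
  exact this

/-- Conjugation of octonions. -/
noncomputable def octConj (x : Fin 8 → ℝ) : Fin 8 → ℝ := (2 * x 0) • octOne - x

lemma cdConj_eq (x : Fin 8 → ℝ) : cdConj 3 x = octConj x := by
  funext i
  fin_cases i <;> simp [cdConj, cdPair, cdFst, cdSnd, octConj, octOne]
  ring

lemma octConj_imag {x : Fin 8 → ℝ} (hx : x 0 = 0) : octConj x = -x := by simp [octConj, hx]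

lemma octConj_dot (x : Fin 8 → ℝ) : octConj x ⬝ᵥ octConj x = x ⬝ᵥ x := by
  simp [octConj, octOne, dot_eq]; ring

lemma octConj_octConj (x : Fin 8 → ℝ) : octConj (octConj x) = x := by
  funext i; fin_cases i <;> simp [octConj, octOne]; ring

lemma octConj_mul (x y : Fin 8 → ℝ) : octConj (x ⋆ y) = octConj y ⋆ octConj x := by
  funext i
  simp only [octConj, octMul_eq]
  fin_cases i <;> simp [octOne] <;> ring

lemma mul_octConj (x y : Fin 8 → ℝ) : (x ⋆ y) ⋆ octConj y = (y ⬝ᵥ y) • x := by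
  funext i
  simp only [octConj, octMul_eq, dot_eq, Matrix.cons_val]
  fin_cases i <;> simp [octOne] <;> ring

lemma octMul_zero_assoc (x y z : Fin 8 → ℝ) : ((x ⋆ y) ⋆ z) 0 = (x ⋆ (y ⋆ z)) 0 := by
  simp only [octMul_eq, Matrix.cons_val]; ring

/-- The associator has norm at most `2|x||y||z|`, by the triangle inequality. -/
lemma assoc_dot_self_le (x y z : Fin 8 → ℝ) :
    ((x ⋆ y) ⋆ z - x ⋆ (y ⋆ z)) ⬝ᵥ ((x ⋆ y) ⋆ z - x ⋆ (y ⋆ z))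
      ≤ 4 * ((x ⬝ᵥ x) * (y ⬝ᵥ y) * (z ⬝ᵥ z)) := by
  have h1 : ((x ⋆ y) ⋆ z) ⬝ᵥ ((x ⋆ y) ⋆ z) = (x ⬝ᵥ x) * (y ⬝ᵥ y) * (z ⬝ᵥ z) := by
    rw [octMul_dot_self, octMul_dot_self]
  have h2 : (x ⋆ (y ⋆ z)) ⬝ᵥ (x ⋆ (y ⋆ z)) = (x ⬝ᵥ x) * (y ⬝ᵥ y) * (z ⬝ᵥ z) := by
    rw [octMul_dot_self, octMul_dot_self, mul_assoc]
  have h3 : 0 ≤ ((x ⋆ y) ⋆ z + x ⋆ (y ⋆ z)) ⬝ᵥ ((x ⋆ y) ⋆ z + x ⋆ (y ⋆ z)) :=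
    dot_self_nonneg _
  simp only [add_dotProduct, dotProduct_add, sub_dotProduct, dotProduct_sub, h1, h2] at h3 ⊢
  linarith

lemma eq_one_of_one_le_mul {p q r : ℝ} (hp : 0 ≤ p) (hq : 0 ≤ q) (hr : 0 ≤ r) (hp1 : p ≤ 1)
    (hq1 : q ≤ 1) (hr1 : r ≤ 1) (h : 1 ≤ p * q * r) : p = 1 ∧ q = 1 ∧ r = 1 := by
  have h1 : p * q ≤ p := mul_le_of_le_one_right hp hq1
  have h2 : p * q ≤ q := mul_le_of_le_one_left hq hp1
  have h3 : p * q * r ≤ p * q := mul_le_of_le_one_right (by positivity) hr1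
  have h4 : p * q * r ≤ r := mul_le_of_le_one_left hr (by nlinarith)
  exact ⟨by linarith, by linarith, by linarith⟩

/-- The equality case of the bound on the associator: unit octonions `a, b, c` with
`(ac)b̄ = -a(cb̄)` have an associator of maximal norm, which forces them to be imaginary,
orthonormal, and a basic triple. -/
lemma isBasicTriple_of_assoc {a b c : Fin 8 → ℝ} (aa : a ⬝ᵥ a = 1) (bb : b ⬝ᵥ b = 1)
    (cc : c ⬝ᵥ c = 1) (h : (a ⋆ c) ⋆ octConj b = -(a ⋆ (c ⋆ octConj b))) :
    IsBasicTriple a b c := by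
  have im : ∀ x : Fin 8 → ℝ, x ⬝ᵥ x = 1 →
      (x - x 0 • octOne) ⬝ᵥ (x - x 0 • octOne) = 1 - x 0 ^ 2 := by
    intro x hx
    simp only [sub_dotProduct, dotProduct_sub, smul_dotProduct, dotProduct_smul, dot_octOne,
      octOne_dot, hx, octOne_zero, smul_eq_mul]
    ring
  have bb' : octConj b ⬝ᵥ octConj b = 1 := by rw [octConj_dot, bb]
  -- if the two products are opposite, the norm of the associator attains the bound `2`
  have four : ∀ x y z : Fin 8 → ℝ, x ⬝ᵥ x = 1 → y ⬝ᵥ y = 1 → z ⬝ᵥ z = 1 →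
      (x ⋆ y) ⋆ z = -(x ⋆ (y ⋆ z)) →
      ((x ⋆ y) ⋆ z - x ⋆ (y ⋆ z)) ⬝ᵥ ((x ⋆ y) ⋆ z - x ⋆ (y ⋆ z)) = 4 := by
    intro x y z hx hy hz e
    rw [eq_neg_iff_add_eq_zero, add_comm] at e
    rw [eq_neg_of_add_eq_zero_left e, sub_neg_eq_add, add_dotProduct, dotProduct_add,
      octMul_dot_self, octMul_dot_self, hx, hy, hz]
    norm_num
  have key := assoc_dot_self_le (a - a 0 • octOne) (c - c 0 • octOne)
    (octConj b - octConj b 0 • octOne)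
  rw [← assoc_imag, four a c _ aa cc bb' h, im a aa, im c cc, im _ bb'] at key
  have nn : ∀ x : Fin 8 → ℝ, x ⬝ᵥ x = 1 → 0 ≤ 1 - x 0 ^ 2 := fun x hx => by
    rw [← im x hx]; exact dot_self_nonneg _
  obtain ⟨ha, hc, hb⟩ := eq_one_of_one_le_mul (nn a aa) (nn c cc) (nn _ bb')
    (by linarith [sq_nonneg (a 0)]) (by linarith [sq_nonneg (c 0)])
    (by linarith [sq_nonneg (octConj b 0)]) (by linarith)
  have a0 : a 0 = 0 := by simpa using ha
  have c0 : c 0 = 0 := by simpa using hc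
  have b0 : b 0 = 0 := by
    have : octConj b 0 = b 0 := by simp [octConj, octOne]; ring
    rw [this] at hb
    simpa using hb
  rw [octConj_imag b0, octMul_neg, octMul_neg, octMul_neg, neg_inj] at h
  have h4 := four a c b aa cc bb h
  have proj : ∀ x y : Fin 8 → ℝ, x ⬝ᵥ x = 1 → y ⬝ᵥ y = 1 →
      (y - (x ⬝ᵥ y) • x) ⬝ᵥ (y - (x ⬝ᵥ y) • x) = 1 - (x ⬝ᵥ y) ^ 2 := by
    intro x y hx hy
    simp only [sub_dotProduct, dotProduct_sub, smul_dotProduct, dotProduct_smul, hx, hy,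
      dotProduct_comm y x, smul_eq_mul]
    ring
  -- removing from one factor its component along another one does not change the associator
  have ac : a ⬝ᵥ c = 0 := by
    have e := assoc_dot_self_le a (c - (a ⬝ᵥ c) • a) b
    have : (a ⋆ (c - (a ⬝ᵥ c) • a)) ⋆ b - a ⋆ ((c - (a ⬝ᵥ c) • a) ⋆ b)
        = (a ⋆ c) ⋆ b - a ⋆ (c ⋆ b) := by
      simp only [octMul_sub, sub_octMul, octMul_smul, smul_octMul, left_alt a0, octMul_self, a0,
        aa, octOne_mul]
      simp
    rw [this, h4, aa, bb, proj a c aa cc] at e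
    nlinarith [sq_nonneg (a ⬝ᵥ c)]
  have cb : c ⬝ᵥ b = 0 := by
    have e := assoc_dot_self_le a c (b - (c ⬝ᵥ b) • c)
    have : (a ⋆ c) ⋆ (b - (c ⬝ᵥ b) • c) - a ⋆ (c ⋆ (b - (c ⬝ᵥ b) • c))
        = (a ⋆ c) ⋆ b - a ⋆ (c ⋆ b) := by
      simp only [octMul_sub, octMul_smul, right_alt c0, octMul_self, c0, cc]
      simp [mul_octOne]
    rw [this, h4, aa, cc, proj c b cc bb] at e
    nlinarith [sq_nonneg (c ⬝ᵥ b)]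
  have ab : a ⬝ᵥ b = 0 := by
    have e := assoc_dot_self_le a c (b - (a ⬝ᵥ b) • a)
    have : (a ⋆ c) ⋆ (b - (a ⬝ᵥ b) • a) - a ⋆ (c ⋆ (b - (a ⬝ᵥ b) • a))
        = (a ⋆ c) ⋆ b - a ⋆ (c ⋆ b) := by
      have flex : (a ⋆ c) ⋆ a = a ⋆ (c ⋆ a) := by
        rw [anticomm a0 c0 ac, neg_octMul, right_alt a0, anticomm c0 a0 (by
          rw [dotProduct_comm, ac]), octMul_neg, left_alt a0]
      simp only [octMul_sub, octMul_smul, flex]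
      abel
    rw [this, h4, aa, cc, proj a b aa bb] at e
    nlinarith [sq_nonneg (a ⬝ᵥ b)]
  refine ⟨a0, b0, c0, aa, bb, cc, ab, ac, by rw [dotProduct_comm, cb], ?_⟩
  have h0 := congrFun h 0
  rw [Pi.neg_apply, ← octMul_zero_assoc, octMul_zero_eq' _ b0] at h0
  rw [octMul_dot a0, dotProduct_comm]
  linarith

lemma sedMul_eq (p q : Fin 16 → ℝ) : sedMul p q = cdPair (n := 3)
    (cdFst (n := 3) p ⋆ cdFst (n := 3) q - octConj (cdSnd (n := 3) q) ⋆ cdSnd (n := 3) p)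
    (cdSnd (n := 3) q ⋆ cdFst (n := 3) p + cdSnd (n := 3) p ⋆ octConj (cdFst (n := 3) q)) := by
  rw [← cdConj_eq, ← cdConj_eq]; rfl

lemma cdFst_cdPair {n : ℕ} (a b : Fin (2 ^ n) → ℝ) : cdFst (cdPair a b) = a := by
  funext i; simp [cdFst, cdPair]

lemma cdSnd_cdPair {n : ℕ} (a b : Fin (2 ^ n) → ℝ) : cdSnd (cdPair a b) = b := by
  funext i; simp [cdSnd, cdPair]

lemma cdPair_fst_snd {n : ℕ} (x : Fin (2 ^ (n + 1)) → ℝ) : cdPair (cdFst x) (cdSnd x) = x := by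
  funext i
  by_cases h : (i : ℕ) < 2 ^ n
  · simp [cdPair, cdFst, h]
  · simp [cdPair, cdSnd, h, Nat.add_sub_cancel' (not_lt.1 h)]

lemma sed_dot (x : Fin 16 → ℝ) : x ⬝ᵥ x
    = cdFst (n := 3) x ⬝ᵥ cdFst (n := 3) x + cdSnd (n := 3) x ⬝ᵥ cdSnd (n := 3) x := by
  simp [dotProduct, Fin.sum_univ_succ, cdFst, cdSnd]; ring

lemma sedNorm_eq_iff (x : Fin 16 → ℝ) : sedNorm x = Real.sqrt 2 ↔ x ⬝ᵥ x = 2 := by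
  rw [sedNorm, Real.sqrt_inj (dot_self_nonneg x) (by norm_num)]

namespace IsBasicTriple

variable {a b c : Fin 8 → ℝ} (h : IsBasicTriple a b c)
include h

lemma mul_bc : b ⋆ c = -(c ⋆ b) := by
  have := h.tripleFrame_mul 5 6
  rw [octMul_eq (Pi.single 5 1)] at this
  simpa [tripleFrame, Fin.sum_univ_succ] using this

lemma mul_cb_a : (c ⋆ b) ⋆ a = c ⋆ (a ⋆ b) := by
  have := h.tripleFrame_mul 3 4
  rw [octMul_eq (Pi.single 3 1)] at this
  simpa [tripleFrame, Fin.sum_univ_succ] using this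

lemma mul_s_a : (c ⋆ (a ⋆ b)) ⋆ a = -(c ⋆ b) := by
  have := h.tripleFrame_mul 7 4
  rw [octMul_eq (Pi.single 7 1)] at this
  simpa [tripleFrame, Fin.sum_univ_succ] using this

lemma mul_s_b : (c ⋆ (a ⋆ b)) ⋆ b = -(a ⋆ c) := by
  have := h.tripleFrame_mul 7 5
  rw [octMul_eq (Pi.single 7 1)] at this
  simpa [tripleFrame, Fin.sum_univ_succ] using this

end IsBasicTriple

/-- The zero divisors `(a, b) (c, d) = 0` of norm `√2` are given by the basic triples. -/
lemma mem_Z_iff (p : (Fin 16 → ℝ) × (Fin 16 → ℝ)) : p ∈ Z ↔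
    IsBasicTriple (cdFst (n := 3) p.1) (cdSnd (n := 3) p.1) (cdFst (n := 3) p.2) ∧
      cdSnd (n := 3) p.2
        = octMul (cdFst (n := 3) p.2) (octMul (cdFst (n := 3) p.1) (cdSnd (n := 3) p.1)) := by
  have mem : p ∈ Z ↔ p.1 ⬝ᵥ p.1 = 2 ∧ p.2 ⬝ᵥ p.2 = 2 ∧ sedMul p.1 p.2 = 0 := by
    rw [← sedNorm_eq_iff, ← sedNorm_eq_iff]; rfl
  rw [mem, sed_dot, sed_dot, sedMul_eq]
  generalize cdFst (n := 3) p.1 = a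
  generalize cdSnd (n := 3) p.1 = b
  generalize cdFst (n := 3) p.2 = c
  generalize cdSnd (n := 3) p.2 = d
  change Fin 8 → ℝ at a b c d
  have pair : ∀ x y : Fin 8 → ℝ, cdPair (n := 3) x y = 0 ↔ x = 0 ∧ y = 0 := by
    intro x y
    constructor
    · intro h
      have h1 := cdFst_cdPair (n := 3) x y
      have h2 := cdSnd_cdPair (n := 3) x y
      rw [h] at h1 h2
      exact ⟨h1.symm, h2.symm⟩
    · rintro ⟨rfl, rfl⟩
      funext i
      simp [cdPair]
  refine Iff.trans (and_congr Iff.rfl (and_congr Iff.rfl (pair _ _))) ?_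
  constructor
  · rintro ⟨hu, hv, e1, e2⟩
    rw [sub_eq_zero] at e1
    rw [add_eq_zero_iff_eq_neg] at e2
    have n1 := congrArg (fun x => x ⬝ᵥ x) e1
    have n2 := congrArg (fun x => x ⬝ᵥ x) e2
    simp only [neg_dotProduct, dotProduct_neg, neg_neg, octMul_dot_self, octConj_dot] at n1 n2
    have bb : b ⬝ᵥ b = 2 - a ⬝ᵥ a := by linarith
    have dd : d ⬝ᵥ d = 2 - c ⬝ᵥ c := by linarith
    rw [bb, dd] at n1 n2
    have aa : a ⬝ᵥ a = 1 := by linarith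
    have cc : c ⬝ᵥ c = 1 := by linarith
    have bb : b ⬝ᵥ b = 1 := by rw [bb, aa]; norm_num
    -- solve the second equation for `d` and substitute it into the first one
    have hd : d = -((b ⋆ octConj c) ⋆ octConj a) := by
      rw [← neg_octMul, ← e2, mul_octConj, aa, one_smul]
    have hd' : octConj d = -(a ⋆ (c ⋆ octConj b)) := by
      have neg : ∀ x, octConj (-x) = -octConj x := fun x => by simp [octConj, neg_add_eq_sub]
      rw [hd, neg, octConj_mul, octConj_mul, octConj_octConj, octConj_octConj]
    have h : (a ⋆ c) ⋆ octConj b = -(a ⋆ (c ⋆ octConj b)) := by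
      rw [e1, mul_octConj, bb, one_smul, hd']
    have T := isBasicTriple_of_assoc aa bb cc h
    refine ⟨T, ?_⟩
    rw [hd, octConj_imag T.c_imag, octConj_imag T.a_imag, octMul_neg, octMul_neg, neg_octMul,
      neg_neg, T.mul_bc, neg_octMul, neg_neg, T.mul_cb_a]
  · rintro ⟨T, rfl⟩
    have s0 : (c ⋆ (a ⋆ b)) 0 = 0 := by
      rw [octMul_zero_eq T.c_imag, dotProduct_comm, T.abc, neg_zero]
    refine ⟨by rw [T.aa, T.bb]; norm_num, ?_, ?_, ?_⟩
    · rw [octMul_dot_self, octMul_dot_self, T.aa, T.bb, T.cc]; norm_num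
    · rw [octConj_imag s0, neg_octMul, T.mul_s_b, neg_neg, sub_self]
    · rw [octConj_imag T.c_imag, octMul_neg, T.mul_s_a, T.mul_bc]; abel

/-- The inverse of the orbit map: it recovers an automorphism from the images of
`e_4, e_5, e_6`. -/
noncomputable def orbitInv (p : (Fin 16 → ℝ) × (Fin 16 → ℝ)) : Matrix (Fin 8) (Fin 8) ℝ :=
  tripleMatrix (cdFst (n := 3) p.1) (cdSnd (n := 3) p.1) (cdFst (n := 3) p.2)

lemma orbitMap_eq (A : Matrix (Fin 8) (Fin 8) ℝ) : orbitMap A =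
    (cdPair (n := 3) (A *ᵥ Pi.single 4 1) (A *ᵥ Pi.single 5 1),
      cdPair (n := 3) (A *ᵥ Pi.single 6 1) (A *ᵥ Pi.single 7 1)) := by
  have h1 : cdFst (n := 3) (e 4 + e 13) = (Pi.single 4 1 : Fin 8 → ℝ) := by
    funext i; fin_cases i <;> simp [cdFst, e]
  have h2 : cdSnd (n := 3) (e 4 + e 13) = (Pi.single 5 1 : Fin 8 → ℝ) := by
    funext i; fin_cases i <;> simp [cdSnd, e]
  have h3 : cdFst (n := 3) (e 6 + e 15) = (Pi.single 6 1 : Fin 8 → ℝ) := by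
    funext i; fin_cases i <;> simp [cdFst, e]
  have h4 : cdSnd (n := 3) (e 6 + e 15) = (Pi.single 7 1 : Fin 8 → ℝ) := by
    funext i; fin_cases i <;> simp [cdSnd, e]
  rw [orbitMap, sedAct, sedAct, h1, h2, h3, h4]

lemma orbitInv_orbitMap {A : Matrix (Fin 8) (Fin 8) ℝ} (hA : A ∈ G2) :
    orbitInv (orbitMap A) = A := by
  rw [orbitMap_eq, orbitInv]
  simp only [cdFst_cdPair, cdSnd_cdPair]
  exact G2_eq_tripleMatrix hA

lemma orbitMap_mem {A : Matrix (Fin 8) (Fin 8) ℝ} (hA : A ∈ G2) : orbitMap A ∈ Z := by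
  rw [orbitMap_eq, mem_Z_iff]
  simp only [cdFst_cdPair, cdSnd_cdPair]
  refine ⟨isBasicTriple_single.map hA, ?_⟩
  have h7 := tripleFrame_single 7
  rw [← h7, ← hA.2, ← hA.2]
  rfl

lemma orbitInv_mem {p : (Fin 16 → ℝ) × (Fin 16 → ℝ)} (hp : p ∈ Z) : orbitInv p ∈ G2 :=
  ((mem_Z_iff p).1 hp).1.tripleMatrix_mem

lemma orbitMap_orbitInv {p : (Fin 16 → ℝ) × (Fin 16 → ℝ)} (hp : p ∈ Z) :
    orbitMap (orbitInv p) = p := by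
  obtain ⟨-, h⟩ := (mem_Z_iff p).1 hp
  have hj : ∀ j, orbitInv p *ᵥ Pi.single j 1 = tripleFrame (cdFst (n := 3) p.1)
    (cdSnd (n := 3) p.1) (cdFst (n := 3) p.2) j := tripleMatrix_mulVec_single _ _ _
  rw [orbitMap_eq, hj, hj, hj, hj]
  have h4 : ∀ a b c : Fin 8 → ℝ, tripleFrame a b c 4 = a := fun _ _ _ => rfl
  have h5 : ∀ a b c : Fin 8 → ℝ, tripleFrame a b c 5 = b := fun _ _ _ => rfl
  have h6 : ∀ a b c : Fin 8 → ℝ, tripleFrame a b c 6 = c := fun _ _ _ => rfl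
  have h7 : ∀ a b c : Fin 8 → ℝ, tripleFrame a b c 7 = c ⋆ (a ⋆ b) := fun _ _ _ => rfl
  rw [h4, h5, h6, h7, ← h, cdPair_fst_snd, cdPair_fst_snd]
  rfl

lemma metricG2_eq (P Q : Matrix (Fin 8) (Fin 8) ℝ) : metricG2 P Q
    = (P *ᵥ Pi.single 4 1) ⬝ᵥ (Q *ᵥ Pi.single 4 1) + (P *ᵥ Pi.single 5 1) ⬝ᵥ (Q *ᵥ Pi.single 5 1)
      + (P *ᵥ Pi.single 6 1) ⬝ᵥ (Q *ᵥ Pi.single 6 1)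
      + (P *ᵥ Pi.single 7 1) ⬝ᵥ (Q *ᵥ Pi.single 7 1) := by
  have h : ∀ a b c d : Fin 8 → ℝ, (cdPair (n := 3) a b : Fin 16 → ℝ) ⬝ᵥ cdPair (n := 3) c d
      = a ⬝ᵥ c + b ⬝ᵥ d := by
    intro a b c d
    simp [dotProduct, Fin.sum_univ_succ, cdPair]
    ring
  rw [metricG2, euclid, orbitMap_eq, orbitMap_eq]
  refine (congrArg₂ (· + ·) (h _ _ _ _) (h _ _ _ _)).trans ?_
  ring

/-- The induced metric is left-invariant because `G_2` acts on `𝕊 × 𝕊` by isometries. -/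
lemma metricG2_mul {A : Matrix (Fin 8) (Fin 8) ℝ} (hA : A ∈ G2) (P Q : Matrix (Fin 8) (Fin 8) ℝ) :
    metricG2 (A * P) (A * Q) = metricG2 P Q := by
  simp only [metricG2_eq, ← Matrix.mulVec_mulVec, G2_dot hA]

/-! ### Local parametrizations -/

section Transfer

variable {F F' : Type*} [NormedAddCommGroup F] [NormedSpace ℝ F]
  [NormedAddCommGroup F'] [NormedSpace ℝ F'] {n : ℕ}

/-- Local parametrizations are transported by a smooth map with a smooth inverse. -/
lemma IsLocalParam.transfer {M : Set F} {N : Set F'} {θ : F → F'} {η : F' → F}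
    (hθ : ContDiff ℝ ∞ θ) (hη : ContDiff ℝ ∞ η) (hM : Set.MapsTo θ M N) (hN : Set.MapsTo η N M)
    (hl : ∀ p ∈ M, η (θ p) = p) (hr : ∀ q ∈ N, θ (η q) = q)
    {V : Set (Fin n → ℝ)} {φ : (Fin n → ℝ) → F} (h : IsLocalParam M V φ) :
    IsLocalParam N V (θ ∘ φ) where
  isOpen := h.isOpen
  smooth := hθ.comp_contDiffOn h.smooth
  immersion := by
    intro x hx
    have dφ : DifferentiableAt ℝ φ x :=
      (h.smooth.differentiableOn (by simp)).differentiableAt (h.isOpen.mem_nhds hx)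
    have dθ : DifferentiableAt ℝ (θ ∘ φ) x :=
      (hθ.differentiable (by simp) _).comp x dφ
    have e : η ∘ (θ ∘ φ) =ᶠ[nhds x] φ :=
      Filter.eventuallyEq_of_mem (h.isOpen.mem_nhds hx) fun y hy => hl _ (h.mapsTo hy)
    have e2 := fderiv_comp x (hη.differentiable (by simp) ((θ ∘ φ) x)) dθ
    rw [e.fderiv_eq] at e2
    have := h.immersion x hx
    rw [e2, ContinuousLinearMap.coe_comp] at this
    exact this.of_comp
  mapsTo := hM.comp h.mapsTo
  openEmbedding := by
    let H : M ≃ₜ N :=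
      { toFun := hM.restrict θ M N
        invFun := hN.restrict η N M
        left_inv := fun p => Subtype.ext (hl p p.2)
        right_inv := fun q => Subtype.ext (hr q q.2)
        continuous_toFun := hθ.continuous.restrict hM
        continuous_invFun := hη.continuous.restrict hN }
    exact H.isOpenEmbedding.comp h.openEmbedding

/-- A smooth parametrization with a smooth left inverse, whose image is cut out of `M` by an open
set, is a local parametrization. -/
lemma isLocalParam_of_leftInverse {M : Set F} {V : Set (Fin n → ℝ)} {φ : (Fin n → ℝ) → F}
    {L : F → (Fin n → ℝ)} {O : Set F} (hV : IsOpen V) (hφ : ContDiffOn ℝ ∞ φ V)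
    (hL : ContDiff ℝ ∞ L) (hm : Set.MapsTo φ V M) (hl : ∀ x ∈ V, L (φ x) = x) (hO : IsOpen O)
    (himg : φ '' V = M ∩ O) : IsLocalParam M V φ where
  isOpen := hV
  smooth := hφ
  immersion := by
    intro x hx
    have dφ : DifferentiableAt ℝ φ x :=
      (hφ.differentiableOn (by simp)).differentiableAt (hV.mem_nhds hx)
    have e : L ∘ φ =ᶠ[nhds x] id := Filter.eventuallyEq_of_mem (hV.mem_nhds hx) hl
    have e2 := fderiv_comp x (hL.differentiable (by simp) (φ x)) dφ
    rw [e.fderiv_eq, fderiv_id] at e2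
    have : Function.Injective (ContinuousLinearMap.id ℝ (Fin n → ℝ)) := Function.injective_id
    rw [e2, ContinuousLinearMap.coe_comp] at this
    exact this.of_comp
  mapsTo := hm
  openEmbedding := by
    have hc : Continuous (hm.restrict φ V M) := hφ.continuousOn.mapsToRestrict hm
    have hrange : Set.range (hm.restrict φ V M) = Subtype.val ⁻¹' O := by
      ext ⟨p, hp⟩
      constructor
      · rintro ⟨x, hx⟩
        have : φ x ∈ M ∩ O := himg ▸ ⟨x, x.2, rfl⟩
        rw [← hx]
        exact this.2
      · intro ho
        obtain ⟨x, hx, e⟩ : p ∈ φ '' V := himg ▸ ⟨hp, ho⟩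
        exact ⟨⟨x, hx⟩, Subtype.ext e⟩
    refine ⟨⟨⟨?_⟩, ?_⟩, ?_⟩
    · refine le_antisymm hc.le_induced ?_
      rintro s ⟨t, ht, rfl⟩
      refine ⟨(fun p : M => L p) ⁻¹' t, ht.preimage (hL.continuous.comp continuous_subtype_val), ?_⟩
      ext x
      change L (φ x) ∈ t ↔ _
      rw [hl x x.2]
      rfl
    · intro x y hxy
      have : φ x = φ y := congrArg Subtype.val hxy
      exact Subtype.ext (by rw [← hl x x.2, this, hl y y.2])
    · rw [hrange]
      exact hO.preimage continuous_subtype_val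

end Transfer

lemma contDiff_octMul {G : Type*} [NormedAddCommGroup G] [NormedSpace ℝ G] {n : WithTop ℕ∞}
    {f g : G → (Fin 8 → ℝ)} (hf : ContDiff ℝ n f) (hg : ContDiff ℝ n g) :
    ContDiff ℝ n (fun x => f x ⋆ g x) :=
  (octBilin.toContinuousBilinearMap.contDiff.comp hf).clm_apply hg

lemma contDiff_tripleMatrix {G : Type*} [NormedAddCommGroup G] [NormedSpace ℝ G]
    {n : WithTop ℕ∞} {f g h : G → (Fin 8 → ℝ)} (hf : ContDiff ℝ n f) (hg : ContDiff ℝ n g)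
    (hh : ContDiff ℝ n h) : ContDiff ℝ n (fun x => tripleMatrix (f x) (g x) (h x)) := by
  refine contDiff_pi.2 fun i => contDiff_pi.2 fun j => ?_
  suffices H : ContDiff ℝ n fun x => tripleFrame (f x) (g x) (h x) j from contDiff_pi.1 H i
  have hfg := contDiff_octMul hf hg
  have hfh := contDiff_octMul hf hh
  have hhg := contDiff_octMul hh hg
  have hs := contDiff_octMul hh hfg
  fin_cases j
  exacts [contDiff_const, hfg, hfh, hhg, hf, hg, hh, hs]

lemma contDiff_entry {n : WithTop ℕ∞} (i j : Fin 8) :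
    ContDiff ℝ n fun A : Matrix (Fin 8) (Fin 8) ℝ => A i j :=
  contDiff_apply_apply ℝ ℝ i j

lemma contDiff_orbitMap : ContDiff ℝ ∞ orbitMap := by
  have hc : ∀ j, ContDiff ℝ ∞ fun A : Matrix (Fin 8) (Fin 8) ℝ => A *ᵥ Pi.single j 1 := by
    intro j
    simp only [Matrix.mulVec_single_one]
    exact contDiff_pi.2 fun i => contDiff_entry i j
  have hp : ∀ f g : Matrix (Fin 8) (Fin 8) ℝ → (Fin 8 → ℝ), ContDiff ℝ ∞ f → ContDiff ℝ ∞ g →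
      ContDiff ℝ ∞ fun A => (cdPair (n := 3) (f A) (g A) : Fin 16 → ℝ) := by
    intro f g hf hg
    refine contDiff_pi.2 fun i => ?_
    by_cases h : (i : ℕ) < 2 ^ 3
    · simp only [cdPair, h, dif_pos]
      exact contDiff_pi.1 hf _
    · simp only [cdPair, h, dif_neg, not_false_eq_true]
      exact contDiff_pi.1 hg _
  have : orbitMap = fun A => _ := funext orbitMap_eq
  rw [this]
  exact (hp _ _ (hc 4) (hc 5)).prodMk (hp _ _ (hc 6) (hc 7))

lemma contDiff_orbitInv : ContDiff ℝ ∞ orbitInv := by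
  refine contDiff_tripleMatrix (contDiff_pi.2 fun i => ?_) (contDiff_pi.2 fun i => ?_)
    (contDiff_pi.2 fun i => ?_)
  · exact (contDiff_apply ℝ ℝ _).comp contDiff_fst
  · exact (contDiff_apply ℝ ℝ _).comp contDiff_fst
  · exact (contDiff_apply ℝ ℝ _).comp contDiff_snd

lemma isDiffeo_orbitMap : IsDiffeo 14 orbitMap G2 Z := by
  refine ⟨⟨fun A hA => orbitMap_mem hA, fun A hA B hB h => ?_, fun p hp =>
    ⟨orbitInv p, orbitInv_mem hp, orbitMap_orbitInv hp⟩⟩, fun V φ h => ?_⟩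
  · rw [← orbitInv_orbitMap hA, h, orbitInv_orbitMap hB]
  · exact h.transfer contDiff_orbitMap contDiff_orbitInv (fun _ hA => orbitMap_mem hA)
      (fun _ hp => orbitInv_mem hp) (fun _ hA => orbitInv_orbitMap hA)
      (fun _ hp => orbitMap_orbitInv hp)

lemma IsLocalParam.orbitInv {V : Set (Fin 14 → ℝ)}
    {ψ : (Fin 14 → ℝ) → (Fin 16 → ℝ) × (Fin 16 → ℝ)} (h : IsLocalParam Z V ψ) :
    IsLocalParam G2 V (orbitInv ∘ ψ) :=
  h.transfer contDiff_orbitInv contDiff_orbitMap (fun _ hp => orbitInv_mem hp)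
    (fun _ hA => orbitMap_mem hA) (fun _ hp => orbitMap_orbitInv hp)
    (fun _ hA => orbitInv_orbitMap hA)

lemma IsLocalParam.mul_left {V : Set (Fin 14 → ℝ)}
    {φ : (Fin 14 → ℝ) → Matrix (Fin 8) (Fin 8) ℝ} (h : IsLocalParam G2 V φ)
    {B : Matrix (Fin 8) (Fin 8) ℝ} (hB : B ∈ G2) : IsLocalParam G2 V ((B * ·) ∘ φ) := by
  have hc : ∀ C : Matrix (Fin 8) (Fin 8) ℝ, ContDiff ℝ ∞ (C * ·) := by
    intro C
    refine contDiff_pi.2 fun i => contDiff_pi.2 fun j => ?_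
    simp only [Matrix.mul_apply]
    exact ContDiff.sum fun k _ => contDiff_const.mul (contDiff_entry k j)
  refine h.transfer (η := (B⁻¹ * ·)) (hc B) (hc B⁻¹) (fun A hA => G2_mul_mem hB hA)
    (fun A hA => G2_mul_mem (G2_inv_mem hB) hA) (fun A _ => ?_) (fun A _ => ?_)
  · exact Matrix.nonsing_inv_mul_cancel_left B A hB.1
  · exact Matrix.mul_nonsing_inv_cancel_left B A hB.1

/-! ### The manifold of basic triples -/

/-- The equations of basic triples, and fourteen of the coordinates of a triple that complete them
to a local coordinate system near `(e_4, e_5, e_6)`. -/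
noncomputable def tripleChart (q : (Fin 8 → ℝ) × (Fin 8 → ℝ) × (Fin 8 → ℝ)) :
    (Fin 10 → ℝ) × (Fin 14 → ℝ) :=
  (![q.1 0, q.2.1 0, q.2.2 0, q.1 ⬝ᵥ q.1, q.2.1 ⬝ᵥ q.2.1, q.2.2 ⬝ᵥ q.2.2, q.1 ⬝ᵥ q.2.1,
      q.1 ⬝ᵥ q.2.2, q.2.1 ⬝ᵥ q.2.2, (q.1 ⋆ q.2.1) ⬝ᵥ q.2.2],
    ![q.1 1, q.1 2, q.1 3, q.1 5, q.1 6, q.1 7, q.2.1 1, q.2.1 2, q.2.1 3, q.2.1 6, q.2.1 7,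
      q.2.2 2, q.2.2 3, q.2.2 7])

lemma isBasicTriple_iff (q : (Fin 8 → ℝ) × (Fin 8 → ℝ) × (Fin 8 → ℝ)) :
    IsBasicTriple q.1 q.2.1 q.2.2 ↔ (tripleChart q).1 = ![0, 0, 0, 1, 1, 1, 0, 0, 0, 0] := by
  constructor
  · intro h
    simp only [tripleChart, h.a_imag, h.b_imag, h.c_imag, h.aa, h.bb, h.cc, h.ab, h.ac, h.bc,
      h.abc]
  · intro h
    have := fun i => congrFun h i
    exact ⟨this 0, this 1, this 2, this 3, this 4, this 5, this 6, this 7, this 8, this 9⟩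

lemma contDiff_tripleChart {n : WithTop ℕ∞} : ContDiff ℝ n tripleChart := by
  have h1 : ∀ i, ContDiff ℝ n fun q : (Fin 8 → ℝ) × (Fin 8 → ℝ) × (Fin 8 → ℝ) => q.1 i :=
    fun i => (contDiff_apply ℝ ℝ i).comp contDiff_fst
  have h2 : ∀ i, ContDiff ℝ n fun q : (Fin 8 → ℝ) × (Fin 8 → ℝ) × (Fin 8 → ℝ) => q.2.1 i :=
    fun i => (contDiff_apply ℝ ℝ i).comp (contDiff_fst.comp contDiff_snd)
  have h3 : ∀ i, ContDiff ℝ n fun q : (Fin 8 → ℝ) × (Fin 8 → ℝ) × (Fin 8 → ℝ) => q.2.2 i :=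
    fun i => (contDiff_apply ℝ ℝ i).comp (contDiff_snd.comp contDiff_snd)
  have h4 : ∀ i, ContDiff ℝ n
      fun q : (Fin 8 → ℝ) × (Fin 8 → ℝ) × (Fin 8 → ℝ) => (q.1 ⋆ q.2.1) i :=
    contDiff_pi.1 (contDiff_octMul (contDiff_pi.2 h1) (contDiff_pi.2 h2))
  have dot : ∀ {f g : (Fin 8 → ℝ) × (Fin 8 → ℝ) × (Fin 8 → ℝ) → (Fin 8 → ℝ)},
      (∀ i, ContDiff ℝ n fun q => f q i) → (∀ i, ContDiff ℝ n fun q => g q i) →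
      ContDiff ℝ n fun q => f q ⬝ᵥ g q := by
    intro f g hf hg
    exact ContDiff.sum fun i _ => (hf i).mul (hg i)
  refine ContDiff.prodMk (contDiff_pi.2 fun i => ?_) (contDiff_pi.2 fun i => ?_)
  · fin_cases i
    exacts [h1 0, h2 0, h3 0, dot h1 h1, dot h2 h2, dot h3 h3, dot h1 h2, dot h1 h3, dot h2 h3,
      dot h4 h3]
  · fin_cases i
    exacts [h1 1, h1 2, h1 3, h1 5, h1 6, h1 7, h2 1, h2 2, h2 3, h2 6, h2 7, h3 2, h3 3, h3 7]

/-- The basic triple of the identity. -/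
noncomputable def baseTriple : (Fin 8 → ℝ) × (Fin 8 → ℝ) × (Fin 8 → ℝ) :=
  (Pi.single 4 1, Pi.single 5 1, Pi.single 6 1)

/-- The chart is a polynomial map of degree at most three on lines, and its derivatives along them
are read off from the linear coefficients. -/
lemma eq_zero_of_hasDerivAt_cubic {F : ℝ → ℝ} (hF : HasDerivAt F 0 0) (c₀ c₁ c₂ c₃ : ℝ)
    (h : ∀ s, F s = c₀ + c₁ * s + c₂ * s ^ 2 + c₃ * s ^ 3) : c₁ = 0 := by
  have h2 : HasDerivAt (fun s : ℝ => c₀ + c₁ * s + c₂ * s ^ 2 + c₃ * s ^ 3) c₁ 0 := by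
    exact (((((hasDerivAt_id (0 : ℝ)).const_mul c₁).const_add c₀).add
      ((hasDerivAt_pow 2 (0 : ℝ)).const_mul c₂)).add
        ((hasDerivAt_pow 3 (0 : ℝ)).const_mul c₃)).congr_deriv (by simp)
  rw [← funext h] at h2
  exact h2.unique hF

/-- The differential of the chart at the base triple is injective: the equations determine the
derivatives of the remaining ten coordinates. -/
lemma fderiv_tripleChart_injective : Function.Injective (fderiv ℝ tripleChart baseTriple) := by
  rw [injective_iff_map_eq_zero]
  rintro ⟨x, y, z⟩ hδ
  have hd : HasDerivAt (fun s : ℝ => tripleChart (baseTriple + s • (x, y, z))) 0 0 := by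
    have h1 : HasFDerivAt tripleChart (fderiv ℝ tripleChart baseTriple)
        (baseTriple + (0 : ℝ) • (x, y, z)) := by
      rw [zero_smul, add_zero]
      exact (contDiff_tripleChart.differentiable (n := 1) (by simp) _).hasFDerivAt
    have h2 : HasDerivAt (fun s : ℝ => baseTriple + s • (x, y, z)) (x, y, z) 0 := by
      simpa using ((hasDerivAt_id (0 : ℝ)).smul_const (x, y, z)).const_add baseTriple
    have := h1.comp_hasDerivAt (0 : ℝ) h2
    rwa [hδ] at this
  have e1 : ∀ i, HasDerivAt (fun s : ℝ => (tripleChart (baseTriple + s • (x, y, z))).1 i) 0 0 :=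
    fun i => hasDerivAt_pi.1 hd.fst i
  have e2 : ∀ i, HasDerivAt (fun s : ℝ => (tripleChart (baseTriple + s • (x, y, z))).2 i) 0 0 :=
    fun i => hasDerivAt_pi.1 hd.snd i
  have x0 := eq_zero_of_hasDerivAt_cubic (e1 0) 0 (x 0) 0 0 (fun s => by
    simp [tripleChart, baseTriple]; ring)
  have y0 := eq_zero_of_hasDerivAt_cubic (e1 1) 0 (y 0) 0 0 (fun s => by
    simp [tripleChart, baseTriple]; ring)
  have z0 := eq_zero_of_hasDerivAt_cubic (e1 2) 0 (z 0) 0 0 (fun s => by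
    simp [tripleChart, baseTriple]; ring)
  have x4 := eq_zero_of_hasDerivAt_cubic (e1 3) 1 (2 * x 4) (x ⬝ᵥ x) 0 (fun s => by
    simp [tripleChart, baseTriple]; ring)
  have y5 := eq_zero_of_hasDerivAt_cubic (e1 4) 1 (2 * y 5) (y ⬝ᵥ y) 0 (fun s => by
    simp [tripleChart, baseTriple]; ring)
  have z6 := eq_zero_of_hasDerivAt_cubic (e1 5) 1 (2 * z 6) (z ⬝ᵥ z) 0 (fun s => by
    simp [tripleChart, baseTriple]; ring)
  have xy := eq_zero_of_hasDerivAt_cubic (e1 6) 0 (x 5 + y 4) (x ⬝ᵥ y) 0 (fun s => by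
    simp [tripleChart, baseTriple]; ring)
  have xz := eq_zero_of_hasDerivAt_cubic (e1 7) 0 (x 6 + z 4) (x ⬝ᵥ z) 0 (fun s => by
    simp [tripleChart, baseTriple]; ring)
  have yz := eq_zero_of_hasDerivAt_cubic (e1 8) 0 (y 6 + z 5) (y ⬝ᵥ z) 0 (fun s => by
    simp [tripleChart, baseTriple]; ring)
  have xyz := eq_zero_of_hasDerivAt_cubic (e1 9) 0 (z 1 - x 3 - y 2)
    ((x ⋆ y) 6 + (x ⋆ Pi.single 5 1) ⬝ᵥ z + (Pi.single 4 1 ⋆ y) ⬝ᵥ z) ((x ⋆ y) ⬝ᵥ z) (fun s => by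
    simp only [tripleChart, baseTriple, dot_eq, octMul_eq]; simp; ring)
  have x1 := eq_zero_of_hasDerivAt_cubic (e2 0) 0 (x 1) 0 0 (fun s => by
    simp [tripleChart, baseTriple]; ring)
  have x2 := eq_zero_of_hasDerivAt_cubic (e2 1) 0 (x 2) 0 0 (fun s => by
    simp [tripleChart, baseTriple]; ring)
  have x3 := eq_zero_of_hasDerivAt_cubic (e2 2) 0 (x 3) 0 0 (fun s => by
    simp [tripleChart, baseTriple]; ring)
  have x5 := eq_zero_of_hasDerivAt_cubic (e2 3) 0 (x 5) 0 0 (fun s => by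
    simp [tripleChart, baseTriple]; ring)
  have x6 := eq_zero_of_hasDerivAt_cubic (e2 4) 0 (x 6) 0 0 (fun s => by
    simp [tripleChart, baseTriple]; ring)
  have x7 := eq_zero_of_hasDerivAt_cubic (e2 5) 0 (x 7) 0 0 (fun s => by
    simp [tripleChart, baseTriple]; ring)
  have y1 := eq_zero_of_hasDerivAt_cubic (e2 6) 0 (y 1) 0 0 (fun s => by
    simp [tripleChart, baseTriple]; ring)
  have y2 := eq_zero_of_hasDerivAt_cubic (e2 7) 0 (y 2) 0 0 (fun s => by
    simp [tripleChart, baseTriple]; ring)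
  have y3 := eq_zero_of_hasDerivAt_cubic (e2 8) 0 (y 3) 0 0 (fun s => by
    simp [tripleChart, baseTriple]; ring)
  have y6 := eq_zero_of_hasDerivAt_cubic (e2 9) 0 (y 6) 0 0 (fun s => by
    simp [tripleChart, baseTriple]; ring)
  have y7 := eq_zero_of_hasDerivAt_cubic (e2 10) 0 (y 7) 0 0 (fun s => by
    simp [tripleChart, baseTriple]; ring)
  have z2 := eq_zero_of_hasDerivAt_cubic (e2 11) 0 (z 2) 0 0 (fun s => by
    simp [tripleChart, baseTriple]; ring)
  have z3 := eq_zero_of_hasDerivAt_cubic (e2 12) 0 (z 3) 0 0 (fun s => by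
    simp [tripleChart, baseTriple]; ring)
  have z7 := eq_zero_of_hasDerivAt_cubic (e2 13) 0 (z 7) 0 0 (fun s => by
    simp [tripleChart, baseTriple]; ring)
  have hx : x = 0 := by
    funext i
    fin_cases i
    exacts [x0, x1, x2, x3, by simpa using x4, x5, x6, x7]
  have hy : y = 0 := by
    funext i
    fin_cases i
    exacts [y0, y1, y2, y3, by simpa [x5] using xy, by simpa using y5, y6, y7]
  have hz : z = 0 := by
    funext i
    fin_cases i
    exacts [z0, by simpa [x3, y2] using xyz, z2, z3, by simpa [x6] using xz,
      by simpa [y6] using yz, by simpa using z6, z7]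
  rw [hx, hy, hz]
  rfl

/-- The local inverse of the chart, given by the inverse function theorem. -/
lemma exists_tripleChart_inverse : ∃ (T : OpenPartialHomeomorph
      ((Fin 8 → ℝ) × (Fin 8 → ℝ) × (Fin 8 → ℝ)) ((Fin 10 → ℝ) × (Fin 14 → ℝ)))
    (U : Set ((Fin 10 → ℝ) × (Fin 14 → ℝ))), (T : _ → _) = tripleChart ∧ baseTriple ∈ T.source ∧
      IsOpen U ∧ tripleChart baseTriple ∈ U ∧ U ⊆ T.target ∧ ContDiffOn ℝ ∞ T.symm U := by
  have hdim : Module.finrank ℝ ((Fin 8 → ℝ) × (Fin 8 → ℝ) × (Fin 8 → ℝ))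
      = Module.finrank ℝ ((Fin 10 → ℝ) × (Fin 14 → ℝ)) := by simp
  let f' : ((Fin 8 → ℝ) × (Fin 8 → ℝ) × (Fin 8 → ℝ)) ≃L[ℝ] ((Fin 10 → ℝ) × (Fin 14 → ℝ)) :=
    (LinearMap.linearEquivOfInjective
      (fderiv ℝ tripleChart baseTriple : _ →ₗ[ℝ] _) fderiv_tripleChart_injective
      hdim).toContinuousLinearEquiv
  have hc : ContDiffAt ℝ ω tripleChart baseTriple := contDiff_tripleChart.contDiffAt
  have hf' : HasFDerivAt tripleChart (f' : _ →L[ℝ] _) baseTriple := by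
    have hcoe : (f' : _ →L[ℝ] _) = fderiv ℝ tripleChart baseTriple :=
      ContinuousLinearMap.ext fun _ => rfl
    rw [hcoe]
    exact (hc.differentiableAt (by simp)).hasFDerivAt
  have hs := hc.to_localInverse hf' (by simp)
  -- an analytic map is smooth on a whole neighbourhood
  obtain ⟨U, hU, hUo, hmem⟩ := eventually_nhds_iff.1 (hs.eventually (by simp))
  refine ⟨hc.toOpenPartialHomeomorph _ hf' (by simp),
    U ∩ (hc.toOpenPartialHomeomorph _ hf' (by simp)).target, rfl,
    hc.mem_toOpenPartialHomeomorph_source hf' (by simp),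
    hUo.inter (OpenPartialHomeomorph.open_target _),
    ⟨hmem, hc.image_mem_toOpenPartialHomeomorph_target hf' (by simp)⟩,
    Set.inter_subset_right, fun y hy => ?_⟩
  exact ((hU y hy.1).of_le le_top).contDiffWithinAt

/-- The triple of columns that determines an automorphism. -/
noncomputable def tripleOf (A : Matrix (Fin 8) (Fin 8) ℝ) :
    (Fin 8 → ℝ) × (Fin 8 → ℝ) × (Fin 8 → ℝ) :=
  (A *ᵥ Pi.single 4 1, A *ᵥ Pi.single 5 1, A *ᵥ Pi.single 6 1)

lemma contDiff_tripleOf {n : WithTop ℕ∞} : ContDiff ℝ n tripleOf := by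
  have hc : ∀ j, ContDiff ℝ n fun A : Matrix (Fin 8) (Fin 8) ℝ => A *ᵥ Pi.single j 1 := by
    intro j
    simp only [Matrix.mulVec_single_one]
    exact contDiff_pi.2 fun i => contDiff_entry i j
  exact (hc 4).prodMk ((hc 5).prodMk (hc 6))

lemma tripleOf_tripleMatrix (q : (Fin 8 → ℝ) × (Fin 8 → ℝ) × (Fin 8 → ℝ)) :
    tripleOf (tripleMatrix q.1 q.2.1 q.2.2) = q := by
  rw [tripleOf, tripleMatrix_mulVec_single, tripleMatrix_mulVec_single,
    tripleMatrix_mulVec_single]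
  rfl

/-- Fixing the values of the equations in the inverse of `tripleChart` parametrizes `G_2` around
`1`. -/
lemma exists_isLocalParam_one : ∃ (V : Set (Fin 14 → ℝ))
    (φ : (Fin 14 → ℝ) → Matrix (Fin 8) (Fin 8) ℝ), IsLocalParam G2 V φ ∧ 1 ∈ φ '' V := by
  obtain ⟨T, U, hT, hb, hU, hbU, hUt, hs⟩ := exists_tripleChart_inverse
  set ι : (Fin 14 → ℝ) → (Fin 10 → ℝ) × (Fin 14 → ℝ) :=
    fun y => (![0, 0, 0, 1, 1, 1, 0, 0, 0, 0], y) with hι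
  have cι : ContDiff ℝ ∞ ι := contDiff_const.prodMk contDiff_id
  have hTs : ∀ z ∈ U, tripleChart (T.symm z) = z := fun z hz => by
    rw [← hT]; exact T.right_inv (hUt hz)
  set φ : (Fin 14 → ℝ) → Matrix (Fin 8) (Fin 8) ℝ := fun y =>
    tripleMatrix (T.symm (ι y)).1 (T.symm (ι y)).2.1 (T.symm (ι y)).2.2 with hφ
  have hO : IsOpen (tripleOf ⁻¹' (T.source ∩ tripleChart ⁻¹' U)) :=
    (T.open_source.inter (hU.preimage (contDiff_tripleChart (n := 0)).continuous)).preimage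
      (contDiff_tripleOf (n := 0)).continuous
  have hm : Set.MapsTo φ (ι ⁻¹' U) G2 := by
    intro y hy
    refine IsBasicTriple.tripleMatrix_mem ((isBasicTriple_iff _).2 ?_)
    rw [hTs _ hy]
  have hsm : ContDiffOn ℝ ∞ φ (ι ⁻¹' U) := by
    have h1 : ContDiff ℝ ∞ fun q : (Fin 8 → ℝ) × (Fin 8 → ℝ) × (Fin 8 → ℝ) =>
        tripleMatrix q.1 q.2.1 q.2.2 := contDiff_tripleMatrix contDiff_fst
      (contDiff_fst.comp contDiff_snd) (contDiff_snd.comp contDiff_snd)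
    exact h1.comp_contDiffOn (hs.comp cι.contDiffOn fun y hy => hy)
  -- an automorphism whose triple lies in the domain of the chart is recovered from its coordinates
  have hback : ∀ A ∈ G2, A ∈ tripleOf ⁻¹' (T.source ∩ tripleChart ⁻¹' U) →
      ∃ y ∈ ι ⁻¹' U, φ y = A := by
    rintro A hA ⟨h1, h2⟩
    have hB : IsBasicTriple (tripleOf A).1 (tripleOf A).2.1 (tripleOf A).2.2 :=
      isBasicTriple_single.map hA
    have e1 : ι (tripleChart (tripleOf A)).2 = tripleChart (tripleOf A) :=
      Prod.ext ((isBasicTriple_iff _).1 hB).symm rfl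
    refine ⟨(tripleChart (tripleOf A)).2, by rw [Set.mem_preimage, e1]; exact h2, ?_⟩
    have e2 : T.symm (tripleChart (tripleOf A)) = tripleOf A := by
      rw [← hT]; exact T.left_inv h1
    rw [hφ]
    simp only [e1, e2]
    exact G2_eq_tripleMatrix hA
  have himg : φ '' (ι ⁻¹' U) = G2 ∩ tripleOf ⁻¹' (T.source ∩ tripleChart ⁻¹' U) := by
    ext A
    constructor
    · rintro ⟨y, hy, rfl⟩
      refine ⟨hm hy, ?_⟩
      rw [Set.mem_preimage, hφ, tripleOf_tripleMatrix]
      refine ⟨T.map_target (hUt hy), ?_⟩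
      rw [Set.mem_preimage, hTs _ hy]
      exact hy
    · rintro ⟨hA, h⟩
      exact hback A hA h
  refine ⟨ι ⁻¹' U, φ, isLocalParam_of_leftInverse (hU.preimage cι.continuous) hsm
    (L := fun A => (tripleChart (tripleOf A)).2)
    (contDiff_snd.comp (contDiff_tripleChart.comp contDiff_tripleOf)) hm (fun y hy => ?_) hO himg,
    ?_⟩
  · have : tripleOf (φ y) = T.symm (ι y) := tripleOf_tripleMatrix _
    simp only [this]
    rw [hTs _ hy]
  · have hb1 : tripleOf 1 = baseTriple := by simp only [tripleOf, baseTriple, Matrix.one_mulVec]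
    rw [himg]
    refine ⟨one_mem_G2, ?_⟩
    rw [Set.mem_preimage, hb1]
    exact ⟨hb, hbU⟩

/-- Left translations carry a parametrization around `1` to any other point. -/
lemma isSubmanifold_G2 : IsSubmanifold 14 G2 := by
  intro A hA
  obtain ⟨V, φ, h, x, hx, h1⟩ := exists_isLocalParam_one
  exact ⟨V, _, h.mul_left hA, x, hx, by simp [h1]⟩

lemma isSubmanifold_Z : IsSubmanifold 14 Z := by
  intro p hp
  obtain ⟨V, φ, h, x, hx, h1⟩ := isSubmanifold_G2 _ (orbitInv_mem hp)
  exact ⟨V, _, isDiffeo_orbitMap.2 V φ h, x, hx, by simp [h1, orbitMap_orbitInv hp]⟩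

/-! ### The Lie algebra of derivations -/

/-- The combinations of the elementary skew matrices that are proportional to `X_0, …, X_13`, with
an arbitrary family in place of the elementary skew matrices. -/
def comb {R : Type*} [AddCommGroup R] (s : Fin 8 → Fin 8 → R) : Fin 14 → R :=
  ![s 4 5 + s 6 7, s 4 6 - s 5 7, s 4 7 + s 5 6,
    s 4 5 - s 6 7 - 2 • s 2 3, s 4 6 + s 5 7 + 2 • s 1 3, s 4 7 - s 5 6 - 2 • s 1 2,
    s 2 4 - s 1 7, s 1 6 + s 2 5, s 2 6 - s 1 5, s 1 4 + s 2 7,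
    s 1 6 - s 2 5 + 2 • s 3 4, s 1 7 + s 2 4 + 2 • s 3 5, s 2 7 - s 1 4 + 2 • s 3 6,
    2 • s 3 7 - s 1 5 - s 2 6]

lemma map_comb {R S : Type*} [AddCommGroup R] [AddCommGroup S] (h : R →+ S)
    (s : Fin 8 → Fin 8 → R) (a : Fin 14) : h (comb s a) = comb (fun i j => h (s i j)) a := by
  fin_cases a <;> simp [comb]

/-- The integral version of the matrix `E i j`. -/
def intE (i j : Fin 8) : Matrix (Fin 8) (Fin 8) ℤ := Matrix.single j i 1 - Matrix.single i j 1

/-- The matrices `X a`, rescaled to be integral. -/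
def intX : Fin 14 → Matrix (Fin 8) (Fin 8) ℤ := comb intE

/-- Twelve times the square of the scaling factor of `X a`. -/
def weight (a : Fin 14) : ℤ :=
  if a < 3 then 3 else if a < 6 then 1 else if a < 10 then 3 else 1

/-- The scaling factor between `X a` and its integral version. -/
noncomputable def scale (a : Fin 14) : ℝ :=
  if a < 3 then 1 / 2 else if a < 6 then Real.sqrt 3 / 6
    else if a < 10 then 1 / 2 else Real.sqrt 3 / 6

lemma scale_sq (a : Fin 14) : scale a * scale a = weight a / 12 := by
  have h : Real.sqrt 3 / 6 * (Real.sqrt 3 / 6) = 1 / 12 := by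
    have := Real.mul_self_sqrt (show (0 : ℝ) ≤ 3 by norm_num)
    linarith
  unfold scale weight
  split_ifs
  · norm_num
  · rw [h]; norm_num
  · norm_num
  · rw [h]; norm_num

lemma weight_pos (a : Fin 14) : 0 < weight a := by
  unfold weight; split_ifs <;> norm_num

lemma scale_ne_zero (a : Fin 14) : scale a ≠ 0 := by
  intro h
  have h1 := scale_sq a
  have h2 := weight_pos a
  rw [h, mul_zero, eq_comm, div_eq_zero_iff] at h1
  rcases h1 with h1 | h1
  · norm_cast at h1; omega
  · norm_num at h1

/-- The inclusion of integral matrices into real ones. -/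
noncomputable abbrev castMat : Matrix (Fin 8) (Fin 8) ℤ →+* Matrix (Fin 8) (Fin 8) ℝ :=
  (Int.castRingHom ℝ).mapMatrix

lemma castMat_intE (i j : Fin 8) : castMat (intE i j) = E i j := by
  ext r c
  simp [intE, E, Matrix.single_apply]

lemma X_eq (a : Fin 14) : X a = scale a • castMat (intX a) := by
  have h := map_comb castMat.toAddMonoidHom intE a
  simp only [RingHom.toAddMonoidHom_eq_coe, AddMonoidHom.coe_coe, castMat_intE] at h
  rw [intX, h]
  fin_cases a <;> simp [comb, scale, X, two_smul] <;> module

lemma trace_mul_intE (M : Matrix (Fin 8) (Fin 8) ℤ) (i j : Fin 8) :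
    (M * intE i j).trace = M i j - M j i := by
  simp [intE, mul_sub, Matrix.trace_mul_single]

lemma trace_mul_intX (M : Matrix (Fin 8) (Fin 8) ℤ) (c : Fin 14) :
    (M * intX c).trace = comb (fun i j => M i j - M j i) c := by
  have h := map_comb ((Matrix.traceAddMonoidHom (Fin 8) ℤ).comp (AddMonoidHom.mulLeft M)) intE c
  rw [intX]
  simpa [trace_mul_intE] using h

lemma trace_castMat (M : Matrix (Fin 8) (Fin 8) ℤ) : (castMat M).trace = (M.trace : ℝ) := by
  simp [Matrix.trace]

/-- The Gram matrix of the integral basis for the trace form. -/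
lemma trace_intX : ∀ a b, weight a * comb (fun i j => intX a i j - intX a j i) b
    = if a = b then -12 else 0 := by decide +kernel

lemma gbi_X (a b : Fin 14) : gbi (X a) (X b) = if a = b then 1 else 0 := by
  have h : gbi (X a) (X b) = -(scale a * scale b * ((intX a * intX b).trace : ℝ)) := by
    rw [gbi, X_eq, X_eq, Matrix.smul_mul, Matrix.mul_smul, ← map_mul, Matrix.trace_smul,
      Matrix.trace_smul, trace_castMat, smul_eq_mul, smul_eq_mul, mul_assoc]
  have h2 := trace_intX a b
  rw [h, trace_mul_intX]
  split_ifs at h2 ⊢ with hab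
  · subst hab
    rw [scale_sq]
    have : (weight a : ℝ) * (comb (fun i j => intX a i j - intX a j i) a : ℤ) = -12 := by
      exact_mod_cast h2
    linarith
  · rcases mul_eq_zero.1 h2 with h3 | h3
    · exact absurd h3 (weight_pos a).ne'
    · rw [h3]; simp

/-- Six times the eigenvalue of the induced metric on `X a`. -/
def eigen (a : Fin 14) : ℤ := if a < 3 then 6 else if a < 6 then 2 else 3

/-- The Gram matrix of the integral basis for the induced metric. -/
lemma metric_intX : ∀ a b, weight a * ((∑ i, intX a i 4 * intX b i 4)
    + (∑ i, intX a i 5 * intX b i 5) + (∑ i, intX a i 6 * intX b i 6)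
    + (∑ i, intX a i 7 * intX b i 7)) = if a = b then 2 * eigen a else 0 := by decide +kernel

lemma metricG2_X (a b : Fin 14) :
    metricG2 (X a) (X b) = if a = b then (eigen a / 6 : ℝ) else 0 := by
  have h : metricG2 (X a) (X b) = scale a * scale b * (((∑ i, intX a i 4 * intX b i 4)
    + (∑ i, intX a i 5 * intX b i 5) + (∑ i, intX a i 6 * intX b i 6)
    + (∑ i, intX a i 7 * intX b i 7) : ℤ) : ℝ) := by
    rw [metricG2_eq, X_eq, X_eq]
    simp only [Matrix.mulVec_single_one]
    push_cast
    simp only [dotProduct, Matrix.col_apply, ← Finset.sum_add_distrib, Finset.mul_sum]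
    refine Finset.sum_congr rfl fun i _ => ?_
    simp only [Matrix.smul_apply, RingHom.mapMatrix_apply, Matrix.map_apply,
      Int.coe_castRingHom, smul_eq_mul]
    ring
  have h2 := metric_intX a b
  rw [h]
  split_ifs at h2 ⊢ with hab
  · subst hab
    rw [scale_sq]
    have h3 : (weight a : ℝ) * (((∑ i, intX a i 4 * intX a i 4)
      + (∑ i, intX a i 5 * intX a i 5) + (∑ i, intX a i 6 * intX a i 6)
      + (∑ i, intX a i 7 * intX a i 7) : ℤ) : ℝ) = 2 * eigen a := by
      exact_mod_cast h2
    linarith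
  · rcases mul_eq_zero.1 h2 with h3 | h3
    · exact absurd h3 (weight_pos a).ne'
    · rw [h3]; simp

/-- The matrices of derivations are the skew-symmetric matrices that kill `1` and satisfy one
linear equation for each imaginary unit `e_m`, involving the three pairs with product `± e_m`. -/
structure IsDerivMatrix {R : Type*} [CommRing R] (D : Matrix (Fin 8) (Fin 8) R) : Prop where
  zero_left : ∀ j, D 0 j = 0
  skew : ∀ i j, D j i = -D i j
  diag : ∀ i, D i i = 0
  one : D 6 7 = D 2 3 + D 4 5
  two : D 5 7 = D 1 3 - D 4 6
  three : D 5 6 = D 1 2 + D 4 7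
  four : D 3 7 = -D 1 5 - D 2 6
  five : D 3 6 = -D 1 4 + D 2 7
  six : D 3 5 = D 1 7 + D 2 4
  seven : D 3 4 = D 1 6 - D 2 5

lemma isDerivMatrix_intX (a : Fin 14) : IsDerivMatrix (intX a) := by
  constructor <;> revert a <;> decide +kernel

lemma isDerivMatrix_X (a : Fin 14) : IsDerivMatrix (X a) := by
  have h := isDerivMatrix_intX a
  have e : ∀ i j, X a i j = scale a * (intX a i j : ℝ) := fun i j => by
    rw [X_eq]; simp
  constructor <;> intros <;> simp only [e]
  · rw [h.zero_left]; simp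
  · rw [h.skew]; simp
  · rw [h.diag]; simp
  · rw [h.one]; push_cast; ring
  · rw [h.two]; push_cast; ring
  · rw [h.three]; push_cast; ring
  · rw [h.four]; push_cast; ring
  · rw [h.five]; push_cast; ring
  · rw [h.six]; push_cast; ring
  · rw [h.seven]; push_cast; ring

lemma IsDerivMatrix.mem_g2 {D : Matrix (Fin 8) (Fin 8) ℝ} (h : IsDerivMatrix D) : D ∈ g2 := by
  have z := h.zero_left
  have d := h.diag
  have s0 : ∀ i, D i 0 = 0 := fun i => by rw [h.skew, z, neg_zero]
  have hv : ∀ x : Fin 8 → ℝ, D *ᵥ x = ![0,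
      D 1 2 * x 2 + D 1 3 * x 3 + D 1 4 * x 4 + D 1 5 * x 5 + D 1 6 * x 6 + D 1 7 * x 7,
      -D 1 2 * x 1 + D 2 3 * x 3 + D 2 4 * x 4 + D 2 5 * x 5 + D 2 6 * x 6 + D 2 7 * x 7,
      -D 1 3 * x 1 - D 2 3 * x 2 + D 3 4 * x 4 + D 3 5 * x 5 + D 3 6 * x 6 + D 3 7 * x 7,
      -D 1 4 * x 1 - D 2 4 * x 2 - D 3 4 * x 3 + D 4 5 * x 5 + D 4 6 * x 6 + D 4 7 * x 7,
      -D 1 5 * x 1 - D 2 5 * x 2 - D 3 5 * x 3 - D 4 5 * x 4 + D 5 6 * x 6 + D 5 7 * x 7,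
      -D 1 6 * x 1 - D 2 6 * x 2 - D 3 6 * x 3 - D 4 6 * x 4 - D 5 6 * x 5 + D 6 7 * x 7,
      -D 1 7 * x 1 - D 2 7 * x 2 - D 3 7 * x 3 - D 4 7 * x 4 - D 5 7 * x 5 - D 6 7 * x 6] := by
    intro x
    funext i
    have e : (D *ᵥ x) i = D i 0 * x 0 + D i 1 * x 1 + D i 2 * x 2 + D i 3 * x 3 + D i 4 * x 4
        + D i 5 * x 5 + D i 6 * x 6 + D i 7 * x 7 := by
      simp [Matrix.mulVec, dotProduct, Fin.sum_univ_succ]; ring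
    rw [e]
    fin_cases i
    · simp [z]
    · simp [s0, d]
    · simp [s0, d, h.skew 1 2]
    · simp [s0, d, h.skew 1 3, h.skew 2 3]; ring
    · simp [s0, d, h.skew 1 4, h.skew 2 4, h.skew 3 4]; ring
    · simp [s0, d, h.skew 1 5, h.skew 2 5, h.skew 3 5, h.skew 4 5]; ring
    · simp [s0, d, h.skew 1 6, h.skew 2 6, h.skew 3 6, h.skew 4 6, h.skew 5 6]; ring
    · simp [s0, d, h.skew 1 7, h.skew 2 7, h.skew 3 7, h.skew 4 7, h.skew 5 7, h.skew 6 7]; ring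
  intro x y
  rw [hv, hv, hv, h.one, h.two, h.three, h.four, h.five, h.six, h.seven]
  funext i
  rw [octMul_eq x y, Pi.add_apply, octMul_eq, octMul_eq]
  simp only [Matrix.cons_val]
  fin_cases i <;> simp <;> ring

lemma octMul_add_octMul_swap (x y : Fin 8 → ℝ) :
    x ⋆ y + y ⋆ x = (2 * x 0) • y + (2 * y 0) • x - (2 * (x ⬝ᵥ y)) • octOne := by
  funext i
  simp only [octMul_eq, dot_eq]
  fin_cases i <;> simp [octOne] <;> ring

/-- A derivation kills `1`; it is skew, by the Leibniz rule for `x² = -|x|²` with `x` imaginary; and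
the seven linear equations come from the Leibniz rule for one product of units each. -/
lemma g2_isDerivMatrix {D : Matrix (Fin 8) (Fin 8) ℝ} (h : D ∈ g2) : IsDerivMatrix D := by
  have h1 : D *ᵥ octOne = 0 := by
    have := h octOne octOne
    rw [octOne_mul, octOne_mul, mul_octOne] at this
    simpa using this
  -- differentiate `x * x = -|x|²`
  have him : ∀ x : Fin 8 → ℝ, x 0 = 0 →
      (2 * (D *ᵥ x) 0) • x = (2 * (x ⬝ᵥ (D *ᵥ x))) • octOne := by
    intro x hx
    have e := h x x
    rw [octMul_self, hx, mul_zero, zero_smul, zero_sub, Matrix.mulVec_neg, Matrix.mulVec_smul, h1,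
      smul_zero, neg_zero, add_comm, octMul_add_octMul_swap, hx, mul_zero, zero_smul,
      zero_add] at e
    exact (sub_eq_zero.1 e.symm)
  have hdot : ∀ x : Fin 8 → ℝ, x 0 = 0 → x ⬝ᵥ (D *ᵥ x) = 0 := by
    intro x hx
    have := congrFun (him x hx) 0
    simpa [hx, octOne] using this.symm
  have hcol : ∀ i, D i 0 = 0 := by
    intro i
    have := congrFun h1 i
    rw [octOne, Matrix.mulVec_single_one] at this
    exact this
  have hrow : ∀ j, D 0 j = 0 := by
    intro j
    by_cases hj : j = 0
    · rw [hj, hcol]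
    · have := congrFun (him (Pi.single j 1) (by simp [Ne.symm hj])) j
      simpa [octOne, hj] using this
  have hskew : ∀ i j, D j i = -D i j := by
    intro i j
    by_cases hi : i = 0
    · rw [hi, hcol, hrow, neg_zero]
    by_cases hj : j = 0
    · rw [hj, hcol, hrow, neg_zero]
    have e0 : ∀ k : Fin 8, k ≠ 0 → (Pi.single k 1 : Fin 8 → ℝ) 0 = 0 := fun k hk => by
      simp [Ne.symm hk]
    have e1 := hdot (Pi.single i 1 + Pi.single j 1) (by simp [Ne.symm hi, Ne.symm hj])
    have e2 := hdot (Pi.single i 1) (e0 i hi)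
    have e3 := hdot (Pi.single j 1) (e0 j hj)
    simp only [Matrix.mulVec_add, add_dotProduct, dotProduct_add, e2, e3] at e1
    simp only [Matrix.mulVec_single_one, single_one_dotProduct, Matrix.col_apply] at e1
    linarith
  have hmul : ∀ i j l : Fin 8, ∑ k, octMul (Pi.single i 1) (Pi.single j 1) k * D l k
      = octMul (D.col i) (Pi.single j 1) l + octMul (Pi.single i 1) (D.col j) l := by
    intro i j l
    have := congrFun (h (Pi.single i 1) (Pi.single j 1)) l
    rw [Matrix.mulVec_single_one, Matrix.mulVec_single_one, Pi.add_apply] at this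
    rw [← this, Matrix.mulVec, dotProduct]
    exact Finset.sum_congr rfl fun k _ => mul_comm _ _
  refine ⟨hrow, hskew, fun i => ?_, ?_, ?_, ?_, ?_, ?_, ?_, ?_⟩
  · linarith [hskew i i]
  · have := hmul 2 4 7
    simp [octMul_eq, Fin.sum_univ_succ] at this
    linarith [hskew 2 3, hskew 4 5, hskew 6 7]
  · have := hmul 1 4 7
    simp [octMul_eq, Fin.sum_univ_succ] at this
    linarith [hskew 1 3, hskew 4 6, hskew 5 7]
  · have := hmul 1 4 6
    simp [octMul_eq, Fin.sum_univ_succ] at this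
    linarith [hskew 1 2, hskew 4 7, hskew 5 6]
  · have := hmul 1 2 7
    simp [octMul_eq, Fin.sum_univ_succ] at this
    linarith [hskew 1 5, hskew 2 6, hskew 3 7]
  · have := hmul 1 2 6
    simp [octMul_eq, Fin.sum_univ_succ] at this
    linarith [hskew 1 4, hskew 2 7, hskew 3 6]
  · have := hmul 1 2 5
    simp [octMul_eq, Fin.sum_univ_succ] at this
    linarith [hskew 1 7, hskew 2 4, hskew 3 5]
  · have := hmul 1 2 4
    simp [octMul_eq, Fin.sum_univ_succ] at this
    linarith [hskew 1 6, hskew 2 5, hskew 3 4]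

lemma IsDerivMatrix.ext {R : Type*} [CommRing R] {D D' : Matrix (Fin 8) (Fin 8) R}
    (h : IsDerivMatrix D) (h' : IsDerivMatrix D') (e12 : D 1 2 = D' 1 2) (e13 : D 1 3 = D' 1 3)
    (e14 : D 1 4 = D' 1 4) (e15 : D 1 5 = D' 1 5) (e16 : D 1 6 = D' 1 6) (e17 : D 1 7 = D' 1 7)
    (e23 : D 2 3 = D' 2 3) (e24 : D 2 4 = D' 2 4) (e25 : D 2 5 = D' 2 5) (e26 : D 2 6 = D' 2 6)
    (e27 : D 2 7 = D' 2 7) (e45 : D 4 5 = D' 4 5) (e46 : D 4 6 = D' 4 6)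
    (e47 : D 4 7 = D' 4 7) : D = D' := by
  have e67 : D 6 7 = D' 6 7 := by rw [h.one, h'.one, e23, e45]
  have e57 : D 5 7 = D' 5 7 := by rw [h.two, h'.two, e13, e46]
  have e56 : D 5 6 = D' 5 6 := by rw [h.three, h'.three, e12, e47]
  have e37 : D 3 7 = D' 3 7 := by rw [h.four, h'.four, e15, e26]
  have e36 : D 3 6 = D' 3 6 := by rw [h.five, h'.five, e14, e27]
  have e35 : D 3 5 = D' 3 5 := by rw [h.six, h'.six, e17, e24]
  have e34 : D 3 4 = D' 3 4 := by rw [h.seven, h'.seven, e16, e25]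
  have lt : ∀ i j : Fin 8, i < j → D i j = D' i j := by
    intro i j hij
    by_cases hi : i = 0
    · rw [hi, h.zero_left, h'.zero_left]
    · fin_cases i <;> fin_cases j <;> first | assumption | exact absurd hij (by decide) |
        exact absurd rfl hi
  ext i j
  rcases lt_trichotomy i j with hij | hij | hij
  · exact lt i j hij
  · rw [hij, h.diag, h'.diag]
  · rw [h.skew, h'.skew, lt j i hij]

lemma span_X : (Submodule.span ℝ (Set.range X) : Set (Matrix (Fin 8) (Fin 8) ℝ)) = g2 := by
  have hsub : (Submodule.span ℝ (Set.range X) : Set (Matrix (Fin 8) (Fin 8) ℝ)) ⊆ g2 := by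
    intro D hD
    refine Submodule.span_induction (p := fun D _ => D ∈ g2) ?_ ?_ ?_ ?_ hD
    · rintro _ ⟨a, rfl⟩
      exact (isDerivMatrix_X a).mem_g2
    · intro x y
      simp [octMul_zero, zero_octMul]
    · intro D D' _ _ h h' x y
      rw [Matrix.add_mulVec, Matrix.add_mulVec, Matrix.add_mulVec, h, h', add_octMul, octMul_add]
      abel
    · intro c D _ h x y
      rw [Matrix.smul_mulVec, Matrix.smul_mulVec, Matrix.smul_mulVec, h, smul_octMul, octMul_smul,
        smul_add]
  apply Set.Subset.antisymm hsub
  · intro D hD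
    have h := g2_isDerivMatrix hD
    -- the coefficients are the components of `D` with respect to the trace form
    set D' := ∑ a, (-(weight a / 6 : ℝ) * comb (fun i j => D i j) a) • castMat (intX a) with hD'
    have hmem : D' ∈ Submodule.span ℝ (Set.range X) := by
      refine Submodule.sum_mem _ fun a _ => Submodule.smul_mem _ _ ?_
      have : castMat (intX a) = (scale a)⁻¹ • X a := by
        rw [X_eq, smul_smul, inv_mul_cancel₀ (scale_ne_zero a), one_smul]
      rw [this]
      exact Submodule.smul_mem _ _ (Submodule.subset_span ⟨a, rfl⟩)
    have h' := g2_isDerivMatrix (hsub hmem)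
    suffices D = D' by rw [this]; exact hmem
    have e : ∀ i j, D' i j
        = ∑ a, -(weight a / 6 : ℝ) * comb (fun i j => D i j) a * (intX a i j : ℝ) := by
      intro i j
      rw [hD', Matrix.sum_apply]
      exact Finset.sum_congr rfl fun a _ => by simp
    refine h.ext h' ?_ ?_ ?_ ?_ ?_ ?_ ?_ ?_ ?_ ?_ ?_ ?_ ?_ ?_ <;> rw [e] <;>
      simp [Fin.sum_univ_succ, intX, comb, intE, weight, two_mul] <;>
      linarith [h.one, h.two, h.three, h.four, h.five, h.six, h.seven]

/-! ### Structure constants and the Ricci tensor in the frame `X` -/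

/-- The nonzero structure constants of the integral basis `intX`, divided by `4`: the entry
`(14 * b + c, n)` of the `a`-th list stands for the triple `a < b < c` with value `4 * n`. -/
def structTable : List (List (ℕ × ℤ)) := [
  [(16, 2), (91, 1), (121, 1), (151, 3), (181, 3)],
  [(92, 1), (107, -1), (152, 3), (167, -3)],
  [(93, 1), (106, 1), (153, 3), (166, 3)],
  [(61, -6), (94, -3), (109, -3), (124, -3), (139, -3), (151, 6), (181, -6)],
  [(97, -3), (110, 3), (123, -3), (136, 3), (152, 6), (167, 6)],
  [(93, 3), (106, -3), (153, 3), (166, -3)]]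

/-- The structure constant of `intX` for the triple `a < b < c`. -/
def structSorted (a b c : Fin 14) : ℤ :=
  4 * ((structTable.getD a []).lookup (14 * b.val + c.val)).getD 0

/-- The integral structure constants `-tr(Y_a [Y_b, Y_c])` of the basis `Y = intX`. -/
def structInt (a b c : Fin 14) : ℤ :=
  if a < b then
    if b < c then structSorted a b c
    else if a < c then -structSorted a c b else structSorted c a b
  else if a < c then -structSorted b a c
    else if b < c then structSorted b c a else -structSorted c b a

/-- The structure constants `gbi (X a) [X b, X c]` of the orthonormal basis `X`. -/
noncomputable def structConst (a b c : Fin 14) : ℝ :=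
  scale a * scale b * scale c * structInt a b c

/-- The eigenvalue of the induced metric on `X a`. -/
noncomputable def metricEigen (a : Fin 14) : ℝ := eigen a / 6

/-- The inverse of `metricEigen a`. -/
def eigenInv (a : Fin 14) : ℤ := if a < 3 then 1 else if a < 6 then 3 else 2

/-- The eigenvalue of the Ricci tensor on `X a`, multiplied by `54`. -/
def ricciEigen (a : Fin 14) : ℤ := if a < 3 then 135 else if a < 6 then 29 else 45

lemma structInt_swap : ∀ a b c, structInt a c b = -structInt a b c := by decide +kernel

lemma structInt_cycl : ∀ a b c, structInt b c a = structInt a b c := by decide +kernel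

/-- The table agrees with the commutators of the integral matrices. -/
lemma structInt_eq_of_lt : ∀ b c a, b < c →
    comb (fun i j => (intX b * intX c - intX c * intX b) i j
      - (intX b * intX c - intX c * intX b) j i) a = -structInt b c a := by decide +kernel

lemma structInt_eq (a b c : Fin 14) :
    (intX a * (intX b * intX c - intX c * intX b)).trace = -structInt a b c := by
  have key : ∀ b c, b < c →
      (intX a * (intX b * intX c - intX c * intX b)).trace = -structInt a b c := by
    intro b c h
    rw [Matrix.trace_mul_comm, trace_mul_intX, structInt_eq_of_lt b c a h, structInt_cycl]
  rcases lt_trichotomy b c with h | h | h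
  · exact key b c h
  · have := structInt_swap a b b
    subst h
    rw [sub_self, mul_zero, Matrix.trace_zero]
    omega
  · rw [← neg_sub, mul_neg, Matrix.trace_neg, key c b h, structInt_swap a c b]

lemma gbi_bracket (a b c : Fin 14) :
    gbi (X a) (X b * X c - X c * X b) = structConst a b c := by
  have h : X a * (X b * X c - X c * X b) = (scale a * scale b * scale c) •
      castMat (intX a * (intX b * intX c - intX c * intX b)) := by
    simp only [X_eq, Matrix.smul_mul, Matrix.mul_smul, map_mul, map_sub, mul_sub, smul_sub,
      smul_smul]
    congr 2 <;> ring
  rw [gbi, h, Matrix.trace_smul, trace_castMat, structInt_eq, structConst, smul_eq_mul]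
  push_cast
  ring

lemma structConst_swap (a b c : Fin 14) : structConst a c b = -structConst a b c := by
  rw [structConst, structInt_swap, structConst]; push_cast; ring

lemma structConst_cycl (a b c : Fin 14) : structConst b c a = structConst a b c := by
  rw [structConst, structInt_cycl, structConst]; ring

lemma metricEigen_mul_inv (a : Fin 14) : metricEigen a * eigenInv a = 1 := by
  have h : eigen a * eigenInv a = 6 := by revert a; decide
  have h' : (eigen a : ℝ) * eigenInv a = 6 := by exact_mod_cast h
  rw [metricEigen]
  linarith

lemma metricEigen_ne_zero (a : Fin 14) : metricEigen a ≠ 0 :=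
  left_ne_zero_of_mul_eq_one (metricEigen_mul_inv a)

lemma inv_metricEigen (a : Fin 14) : (metricEigen a)⁻¹ = eigenInv a :=
  inv_eq_of_mul_eq_one_right (metricEigen_mul_inv a)

/-- The factor of `f b m c * f b m d` in the Ricci tensor, multiplied by `144`. -/
def ricciFactor (b m c d : Fin 14) : ℤ :=
  12 * (6 + (eigen d - eigen m) * eigenInv b)
    - (6 + (eigen m - eigen c) * eigenInv b) * (6 + (eigen d - eigen b) * eigenInv m)

/-- The Ricci tensor in the frame, as an identity between integers. -/
lemma sum_ricciFactor : ∀ c d, weight c * ∑ b, ∑ m, weight b * weight m *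
    structInt b m c * structInt b m d * ricciFactor b m c d
      = if c = d then 4608 * ricciEigen c else 0 := by decide +kernel

/-- The Ricci tensor in the frame in terms of the integral structure constants. -/
lemma sum_frameCurv_eq (c d : Fin 14) :
    ∑ b, frameCurv structConst metricEigen b c b d = scale c * scale d / 20736 *
      ((∑ b, ∑ m, weight b * weight m * structInt b m c * structInt b m d
        * ricciFactor b m c d : ℤ) : ℝ) := by
  -- hence the connection matrices have `γ^b_bm = 0`, and one of the three terms drops out
  have hz : ∀ b m, structConst b b m = 0 := fun b m => by
    have h1 := structConst_swap m b b
    have h2 := structConst_cycl m b b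
    have h3 := structConst_cycl b b m
    linarith
  push_cast
  rw [Finset.mul_sum]
  refine Finset.sum_congr rfl fun b _ => ?_
  simp only [frameCurv, Matrix.sub_apply, Matrix.mul_apply, Matrix.sum_apply, Matrix.smul_apply,
    smul_eq_mul]
  rw [← Finset.sum_sub_distrib, ← Finset.sum_sub_distrib, Finset.mul_sum]
  refine Finset.sum_congr rfl fun m _ => ?_
  have e1 : structConst b c m = -structConst b m c := structConst_swap _ _ _
  have e2 : structConst m b d = -structConst b m d := by
    rw [← structConst_cycl, structConst_swap]
  have e3 : structConst m b c = -structConst b m c := by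
    rw [← structConst_cycl, structConst_swap]
  have e4 : structConst b m c * structConst b m d = scale c * scale d / 144 *
      (weight b * weight m * structInt b m c * structInt b m d) := by
    rw [structConst, structConst]
    calc _ = (scale b * scale b) * (scale m * scale m) * (scale c * scale d) *
        (structInt b m c * structInt b m d) := by ring
      _ = _ := by rw [scale_sq, scale_sq]; ring
  simp only [frameConn, Matrix.of_apply, hz, e1, e2, e3, div_eq_mul_inv _ (metricEigen _),
    inv_metricEigen]
  rw [show ∀ p q r s u v w : ℝ, 1 / 2 * 0 * p * q - 1 / 2 * -r * s * (1 / 2 * -u * v)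
    - -r * (1 / 2 * u * w) = r * u * (1 / 2 * w - 1 / 4 * s * v) by intros; ring, e4]
  simp only [metricEigen, ricciFactor]
  push_cast
  ring

/-- The Ricci tensor is diagonal in the frame `X`. -/
lemma sum_frameCurv (c d : Fin 14) :
    ∑ b, frameCurv structConst metricEigen b c b d
      = if c = d then (ricciEigen c / 54 : ℝ) else 0 := by
  rw [sum_frameCurv_eq]
  have h := sum_ricciFactor c d
  split_ifs at h ⊢ with hcd
  · subst hcd
    rw [scale_sq]
    have h' : (weight c : ℝ) * ((∑ b, ∑ m, weight b * weight m * structInt b m c *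
        structInt b m c * ricciFactor b m c c : ℤ) : ℝ) = 4608 * ricciEigen c := by
      exact_mod_cast h
    linarith
  · rcases mul_eq_zero.1 h with h3 | h3
    · exact absurd h3 (weight_pos c).ne'
    · rw [h3]; simp

/-! ### The Maurer-Cartan coframe of a local parametrization -/

/-- `gbi` as a bilinear map. -/
noncomputable def gbiBilin :
    Matrix (Fin 8) (Fin 8) ℝ →ₗ[ℝ] Matrix (Fin 8) (Fin 8) ℝ →ₗ[ℝ] ℝ :=
  LinearMap.mk₂ ℝ gbi
    (fun P P' Q => by simp only [gbi, add_mul, Matrix.trace_add]; ring)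
    (fun c P Q => by simp only [gbi, Matrix.smul_mul, Matrix.trace_smul, smul_eq_mul]; ring)
    (fun P Q Q' => by simp only [gbi, mul_add, Matrix.trace_add]; ring)
    (fun c P Q => by simp only [gbi, Matrix.mul_smul, Matrix.trace_smul, smul_eq_mul]; ring)

/-- `orbitMap` as a linear map. -/
noncomputable def orbitLin : Matrix (Fin 8) (Fin 8) ℝ →ₗ[ℝ] (Fin 16 → ℝ) × (Fin 16 → ℝ) where
  toFun := orbitMap
  map_add' A B := by
    have h : ∀ a b c d : Fin 8 → ℝ, (cdPair (n := 3) (a + b) (c + d) : Fin 16 → ℝ)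
        = cdPair (n := 3) a c + cdPair (n := 3) b d := by
      intro a b c d
      funext i
      simp only [cdPair, Pi.add_apply]
      split_ifs <;> rfl
    rw [orbitMap_eq, orbitMap_eq, orbitMap_eq]
    simp only [Matrix.add_mulVec]
    exact Prod.ext (h _ _ _ _) (h _ _ _ _)
  map_smul' r A := by
    have h : ∀ a b : Fin 8 → ℝ, (cdPair (n := 3) (r • a) (r • b) : Fin 16 → ℝ)
        = r • cdPair (n := 3) a b := by
      intro a b
      funext i
      simp only [cdPair, Pi.smul_apply]
      split_ifs <;> rfl
    rw [orbitMap_eq, orbitMap_eq]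
    simp only [Matrix.smul_mulVec]
    exact Prod.ext (h _ _) (h _ _)

/-- The induced metric `metricG2` as a bilinear map. -/
noncomputable def metricBilin :
    Matrix (Fin 8) (Fin 8) ℝ →ₗ[ℝ] Matrix (Fin 8) (Fin 8) ℝ →ₗ[ℝ] ℝ :=
  LinearMap.mk₂ ℝ metricG2
    (fun P P' Q => by simp only [metricG2_eq, Matrix.add_mulVec, add_dotProduct]; ring)
    (fun c P Q => by
      simp only [metricG2_eq, Matrix.smul_mulVec, smul_dotProduct, smul_eq_mul]; ring)
    (fun P Q Q' => by simp only [metricG2_eq, Matrix.add_mulVec, dotProduct_add]; ring)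
    (fun c P Q => by
      simp only [metricG2_eq, Matrix.smul_mulVec, dotProduct_smul, smul_eq_mul]; ring)

lemma gbi_apply (P Q : Matrix (Fin 8) (Fin 8) ℝ) : gbi P Q = ∑ r, ∑ s, -P r s * Q s r := by
  simp [gbi, Matrix.trace, Matrix.mul_apply]

lemma gbi_sum (P : Matrix (Fin 8) (Fin 8) ℝ) (p : Fin 14 → ℝ)
    (Q : Fin 14 → Matrix (Fin 8) (Fin 8) ℝ) :
    gbi P (∑ a, p a • Q a) = ∑ a, p a * gbi P (Q a) := by
  have : gbiBilin P (∑ a, p a • Q a) = ∑ a, p a * gbiBilin P (Q a) := by simp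
  exact this

lemma metricG2_sum (p q : Fin 14 → ℝ) :
    metricG2 (∑ a, p a • X a) (∑ a, q a • X a) = ∑ a, p a * metricEigen a * q a := by
  have : metricBilin (∑ a, p a • X a) (∑ a, q a • X a)
      = ∑ b, ∑ a, q b * (p a * metricBilin (X a) (X b)) := by
    simp [Finset.mul_sum]
  refine this.trans (Finset.sum_congr rfl fun b _ => ?_)
  have hX : ∀ a, metricBilin (X a) (X b) = if a = b then metricEigen a else 0 := fun a =>
    metricG2_X a b
  simp only [hX, mul_ite, mul_zero, Finset.sum_ite_eq', Finset.mem_univ, if_true]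
  ring

/-- The expansion of a derivation in the orthonormal basis `X`. -/
lemma g2_eq_sum {D : Matrix (Fin 8) (Fin 8) ℝ} (hD : D ∈ g2) : D = ∑ a, gbi (X a) D • X a := by
  rw [← span_X, SetLike.mem_coe, Submodule.mem_span_range_iff_exists_fun] at hD
  obtain ⟨c, rfl⟩ := hD
  refine Finset.sum_congr rfl fun a _ => ?_
  rw [gbi_sum]
  simp [gbi_X]

/-- The components of a bracket are given by the structure constants. -/
lemma gbi_commutator (a : Fin 14) (p q : Fin 14 → ℝ) :
    gbi (X a) ((∑ b, p b • X b) * (∑ c, q c • X c) - (∑ c, q c • X c) * (∑ b, p b • X b))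
      = ∑ b, ∑ c, structConst a b c * p b * q c := by
  have h : (∑ b, p b • X b) * (∑ c, q c • X c) - (∑ c, q c • X c) * (∑ b, p b • X b)
      = ∑ b, p b • ∑ c, q c • (X b * X c - X c * X b) := by
    simp only [Finset.sum_mul_sum, smul_sub, Finset.sum_sub_distrib, Finset.smul_sum,
      Matrix.smul_mul, Matrix.mul_smul]
    congr 1
    · exact Finset.sum_congr rfl fun b _ => Finset.sum_congr rfl fun c _ => smul_comm _ _ _
    · exact Finset.sum_comm
  rw [h, gbi_sum]
  refine Finset.sum_congr rfl fun b _ => ?_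
  rw [gbi_sum, Finset.mul_sum]
  refine Finset.sum_congr rfl fun c _ => ?_
  rw [gbi_bracket]
  ring

/-- The matrix of the forms `X^a` in the coordinates given by `φ`. -/
noncomputable def frameMatrix (φ : (Fin 14 → ℝ) → Matrix (Fin 8) (Fin 8) ℝ) (x : Fin 14 → ℝ) :
    Matrix (Fin 14) (Fin 14) ℝ :=
  Matrix.of fun a i => coframe a (φ x) (fderiv ℝ φ x (Pi.single i 1))

lemma frameMatrix_mulVec (φ : (Fin 14 → ℝ) → Matrix (Fin 8) (Fin 8) ℝ) (x v : Fin 14 → ℝ)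
    (a : Fin 14) : (frameMatrix φ x *ᵥ v) a = coframe a (φ x) (fderiv ℝ φ x v) := by
  have hv : (φ x)⁻¹ * fderiv ℝ φ x v
      = ∑ i, v i • ((φ x)⁻¹ * fderiv ℝ φ x (Pi.single i 1)) := by
    conv_lhs => rw [pi_eq_sum_univ' v]
    rw [map_sum, Finset.mul_sum]
    refine Finset.sum_congr rfl fun i _ => ?_
    rw [map_smul, Matrix.mul_smul]
  rw [coframe, hv, gbi_sum, Matrix.mulVec, dotProduct]
  exact Finset.sum_congr rfl fun i _ => mul_comm _ _

section

variable {V : Set (Fin 14 → ℝ)} {φ : (Fin 14 → ℝ) → Matrix (Fin 8) (Fin 8) ℝ}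
  (h : IsLocalParam G2 V φ)

include h

lemma IsLocalParam.contDiffOn_entry (r s : Fin 8) : ContDiffOn ℝ ∞ (fun y => φ y r s) V :=
  (contDiff_entry r s).comp_contDiffOn h.smooth

lemma IsLocalParam.hasFDerivAt {x : Fin 14 → ℝ} (hx : x ∈ V) :
    HasFDerivAt φ (fderiv ℝ φ x) x :=
  ((h.smooth.differentiableOn (by simp)).differentiableAt (h.isOpen.mem_nhds hx)).hasFDerivAt

lemma IsLocalParam.matPd_eq {x : Fin 14 → ℝ} (hx : x ∈ V) (i : Fin 14) :
    matPd i φ x = fderiv ℝ φ x (Pi.single i 1) := by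
  ext r s
  have h1 := (hasFDerivAt_pi'.1 (h.hasFDerivAt hx) r)
  have h2 := (hasFDerivAt_pi'.1 h1 s)
  rw [matPd, Matrix.of_apply, pd, h2.fderiv]
  rfl

lemma IsLocalParam.mul_left_cancel {x : Fin 14 → ℝ} (hx : x ∈ V)
    (P : Matrix (Fin 8) (Fin 8) ℝ) : φ x * ((φ x)⁻¹ * P) = P := by
  have hG := h.mapsTo hx
  rw [G2_inv hG, ← mul_assoc, G2_mul_transpose hG, one_mul]

/-- The Maurer-Cartan form takes its values in the Lie algebra. -/
lemma IsLocalParam.inv_mul_fderiv_mem {x : Fin 14 → ℝ} (hx : x ∈ V) (v : Fin 14 → ℝ) :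
    (φ x)⁻¹ * fderiv ℝ φ x v ∈ g2 := by
  intro u w
  have hG := h.mapsTo hx
  let L : (Fin 8 → ℝ) → (Matrix (Fin 8) (Fin 8) ℝ →L[ℝ] (Fin 8 → ℝ)) := fun z =>
    LinearMap.toContinuousLinearMap
      { toFun := fun A => A *ᵥ z
        map_add' := fun A B => Matrix.add_mulVec A B z
        map_smul' := fun c A => Matrix.smul_mulVec c A z }
  have hL : ∀ z, HasFDerivAt (fun y => φ y *ᵥ z) ((L z).comp (fderiv ℝ φ x)) x := fun z =>
    (L z).hasFDerivAt.comp x (h.hasFDerivAt hx)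
  -- differentiate `φ (u w) = (φ u) (φ w)`
  have e1 := hL (u ⋆ w)
  have e2 := (octBilin.toContinuousBilinearMap.hasFDerivAt_of_bilinear (hL u) (hL w))
  have e3 := e1.unique (e2.congr_of_eventuallyEq
    (Filter.eventuallyEq_of_mem (h.isOpen.mem_nhds hx) fun y hy => (h.mapsTo hy).2 u w))
  have e4 : fderiv ℝ φ x v *ᵥ (u ⋆ w)
      = (φ x *ᵥ u) ⋆ (fderiv ℝ φ x v *ᵥ w) + (fderiv ℝ φ x v *ᵥ u) ⋆ (φ x *ᵥ w) :=
    DFunLike.congr_fun e3 v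
  refine G2_injective hG ?_
  rw [Matrix.mulVec_mulVec, h.mul_left_cancel hx, Matrix.mulVec_add, hG.2, hG.2,
    Matrix.mulVec_mulVec, Matrix.mulVec_mulVec, h.mul_left_cancel hx, e4, add_comm]

lemma IsLocalParam.inv_mul_fderiv_eq {x : Fin 14 → ℝ} (hx : x ∈ V) (v : Fin 14 → ℝ) :
    (φ x)⁻¹ * fderiv ℝ φ x v = ∑ a, (frameMatrix φ x *ᵥ v) a • X a := by
  simp only [frameMatrix_mulVec]
  exact g2_eq_sum (h.inv_mul_fderiv_mem hx v)

lemma IsLocalParam.det_frameMatrix_ne_zero {x : Fin 14 → ℝ} (hx : x ∈ V) :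
    (frameMatrix φ x).det ≠ 0 := by
  intro h0
  obtain ⟨v, hv, hv0⟩ := Matrix.exists_mulVec_eq_zero_iff.2 h0
  apply hv
  apply h.immersion x hx
  have h1 : fderiv ℝ φ x v = 0 := by
    rw [← h.mul_left_cancel hx (fderiv ℝ φ x v), h.inv_mul_fderiv_eq hx, hv0]
    simp
  exact h1.trans (map_zero _).symm

lemma IsLocalParam.metricG2_fderiv {x : Fin 14 → ℝ} (hx : x ∈ V) (v w : Fin 14 → ℝ) :
    metricG2 (fderiv ℝ φ x v) (fderiv ℝ φ x w)
      = ∑ a, (frameMatrix φ x *ᵥ v) a * metricEigen a * (frameMatrix φ x *ᵥ w) a := by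
  rw [← h.mul_left_cancel hx (fderiv ℝ φ x v), ← h.mul_left_cancel hx (fderiv ℝ φ x w),
    metricG2_mul (h.mapsTo hx), h.inv_mul_fderiv_eq hx, h.inv_mul_fderiv_eq hx, metricG2_sum]

lemma IsLocalParam.metricCoeff_eq {x : Fin 14 → ℝ} (hx : x ∈ V) :
    metricCoeff metricG2 φ x
      = (frameMatrix φ x)ᵀ * Matrix.diagonal metricEigen * frameMatrix φ x := by
  refine Matrix.ext fun i j => (h.metricG2_fderiv hx (Pi.single i 1) (Pi.single j 1)).trans ?_
  rw [Matrix.mul_apply]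
  simp [Matrix.mul_diagonal]

lemma IsLocalParam.frameMatrix_eq {x : Fin 14 → ℝ} (hx : x ∈ V) (a i : Fin 14) :
    frameMatrix φ x a i = gbi (X a) ((φ x)ᵀ * matPd i φ x) := by
  rw [frameMatrix, Matrix.of_apply, coframe, G2_inv (h.mapsTo hx), h.matPd_eq hx]

lemma IsLocalParam.contDiffOn_form (i : Fin 14) (r s : Fin 8) :
    ContDiffOn ℝ ∞ (fun y => ((φ y)ᵀ * matPd i φ y) r s) V := by
  simp only [Matrix.mul_apply, Matrix.transpose_apply]
  exact ContDiffOn.sum fun k _ =>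
    (h.contDiffOn_entry k r).mul (contDiffOn_pd h.isOpen (h.contDiffOn_entry k s) i)

lemma IsLocalParam.contDiffOn_frameMatrix (a i : Fin 14) :
    ContDiffOn ℝ ∞ (fun y => frameMatrix φ y a i) V := by
  refine ContDiffOn.congr ?_ fun y hy => h.frameMatrix_eq hy a i
  simp only [gbi_apply]
  exact ContDiffOn.sum fun r _ => ContDiffOn.sum fun s _ =>
    contDiffOn_const.mul (h.contDiffOn_form i s r)

/-- The Maurer-Cartan equation, for the left-invariant matrix form `φᵀ dφ`. -/
lemma IsLocalParam.matPd_form {x : Fin 14 → ℝ} (hx : x ∈ V) (i j : Fin 14) :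
    matPd i (fun y => (φ y)ᵀ * matPd j φ y) x - matPd j (fun y => (φ y)ᵀ * matPd i φ y) x
      = -(((φ x)ᵀ * matPd i φ x) * ((φ x)ᵀ * matPd j φ x)
        - ((φ x)ᵀ * matPd j φ x) * ((φ x)ᵀ * matPd i φ x)) := by
  have hG := h.mapsTo hx
  -- differentiate `∂_j φ = φ (φᵀ ∂_j φ)` and use the symmetry of the second derivative
  have key : ∀ i j, matPd i (matPd j φ) x
      = φ x * (((φ x)ᵀ * matPd i φ x) * ((φ x)ᵀ * matPd j φ x)
        + matPd i (fun y => (φ y)ᵀ * matPd j φ y) x) := by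
    intro i j
    have e1 : matPd i (matPd j φ) x = matPd i (fun y => φ y * ((φ y)ᵀ * matPd j φ y)) x := by
      ext r s
      refine pd_congr h.isOpen (fun y hy => congrFun (congrFun ?_ r) s) i hx
      change matPd j φ y = φ y * ((φ y)ᵀ * matPd j φ y)
      rw [← mul_assoc, G2_mul_transpose (h.mapsTo hy), one_mul]
    have hd : ∀ {f : (Fin 14 → ℝ) → ℝ}, ContDiffOn ℝ ∞ f V → DifferentiableAt ℝ f x := fun hf =>
      (hf.differentiableOn (by simp)).differentiableAt (h.isOpen.mem_nhds hx)
    rw [e1, matPd_mul (fun r s => hd (h.contDiffOn_entry r s))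
      (fun r s => hd (h.contDiffOn_form j r s)), mul_add, ← mul_assoc (φ x), ← mul_assoc (φ x),
      G2_mul_transpose hG, one_mul]
  have hc : matPd i (matPd j φ) x = matPd j (matPd i φ) x := by
    ext r s
    exact pd_comm h.isOpen (h.contDiffOn_entry r s) i j hx
  rw [key i j, key j i] at hc
  have := congrArg ((φ x)ᵀ * ·) hc
  simp only [← mul_assoc (φ x)ᵀ (φ x), G2_transpose_mul hG, one_mul] at this
  rw [neg_sub, sub_eq_sub_iff_add_eq_add, add_comm, this, add_comm]

lemma IsLocalParam.maurerCartan {x : Fin 14 → ℝ} (hx : x ∈ V) (a i j : Fin 14) :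
    pd i (fun y => frameMatrix φ y a j) x - pd j (fun y => frameMatrix φ y a i) x
      = -∑ b, ∑ c, structConst a b c * frameMatrix φ x b i * frameMatrix φ x c j := by
  have hp : ∀ i j, pd i (fun y => frameMatrix φ y a j) x
      = gbi (X a) (matPd i (fun y => (φ y)ᵀ * matPd j φ y) x) := by
    intro i j
    have hd : ∀ r s, DifferentiableAt ℝ (fun y => ((φ y)ᵀ * matPd j φ y) r s) x := fun r s =>
      ((h.contDiffOn_form j r s).differentiableOn (by simp)).differentiableAt
        (h.isOpen.mem_nhds hx)
    rw [pd_congr h.isOpen (fun y hy => h.frameMatrix_eq hy a j) i hx]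
    simp only [gbi_apply]
    rw [pd_sum _ fun r _ => DifferentiableAt.fun_sum fun s _ => (hd s r).const_mul _]
    refine Finset.sum_congr rfl fun r _ => ?_
    rw [pd_sum _ fun s _ => (hd s r).const_mul _]
    exact Finset.sum_congr rfl fun s _ => pd_const_mul (hd s r) _ i
  have hs : ∀ P Q, gbi (X a) (P - Q) = gbi (X a) P - gbi (X a) Q := fun P Q =>
    (gbiBilin (X a)).map_sub P Q
  have hn : ∀ P, gbi (X a) (-P) = -gbi (X a) P := fun P => (gbiBilin (X a)).map_neg P
  have hf : ∀ i, (φ x)ᵀ * matPd i φ x = ∑ b, frameMatrix φ x b i • X b := by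
    intro i
    have := h.inv_mul_fderiv_eq hx (Pi.single i 1)
    rw [G2_inv (h.mapsTo hx), ← h.matPd_eq hx] at this
    simpa using this
  rw [hp, hp, ← hs, h.matPd_form hx, hn, hf, hf, gbi_commutator]

/-! ### The Ricci tensor of the induced metric -/

/-- The left-invariant forms are a Maurer-Cartan coframe in the coordinates given by `φ`, for every
matrix function that agrees with the metric on the domain of `φ`. -/
lemma IsLocalParam.isMaurerCartanCoframe {g : (Fin 14 → ℝ) → Matrix (Fin 14) (Fin 14) ℝ}
    (hg : ∀ x ∈ V, g x = metricCoeff metricG2 φ x) :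
    IsMaurerCartanCoframe V structConst metricEigen (frameMatrix φ) g where
  isOpen := h.isOpen
  smooth := h.contDiffOn_frameMatrix
  det_ne_zero _ hx := h.det_frameMatrix_ne_zero hx
  swap := structConst_swap
  cycl := structConst_cycl
  ne_zero := metricEigen_ne_zero
  metric x hx := by rw [hg x hx, h.metricCoeff_eq hx]
  maurerCartan _ hx := h.maurerCartan hx

lemma IsLocalParam.ricci_eq {g : (Fin 14 → ℝ) → Matrix (Fin 14) (Fin 14) ℝ}
    (hg : ∀ x ∈ V, g x = metricCoeff metricG2 φ x) {x : Fin 14 → ℝ} (hx : x ∈ V)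
    (v w : Fin 14 → ℝ) : ricci g x v w
      = ∑ a, (ricciEigen a / 54 : ℝ) * ((frameMatrix φ x *ᵥ v) a * (frameMatrix φ x *ᵥ w) a) := by
  rw [(h.isMaurerCartanCoframe hg).ricci_eq hx]
  refine Finset.sum_congr rfl fun c _ => ?_
  simp only [sum_frameCurv, mul_ite, mul_zero, Finset.sum_ite_eq, Finset.mem_univ, if_true]
  ring

/-- The eigenvalues of the Ricci tensor are positive and the coframe is nondegenerate. -/
lemma IsLocalParam.ricci_pos {g : (Fin 14 → ℝ) → Matrix (Fin 14) (Fin 14) ℝ}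
    (hg : ∀ x ∈ V, g x = metricCoeff metricG2 φ x) {x : Fin 14 → ℝ} (hx : x ∈ V)
    {w : Fin 14 → ℝ} (hw : w ≠ 0) : 0 < ricci g x w w := by
  rw [h.ricci_eq hg hx]
  have hpos : ∀ a, (0 : ℝ) < ricciEigen a / 54 := fun a => by
    have : 0 < ricciEigen a := by revert a; decide
    have : (0 : ℝ) < ricciEigen a := by exact_mod_cast this
    positivity
  have hne : frameMatrix φ x *ᵥ w ≠ 0 := fun h0 =>
    h.det_frameMatrix_ne_zero hx (Matrix.exists_mulVec_eq_zero_iff.1 ⟨w, hw, h0⟩)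
  obtain ⟨a, ha⟩ := Function.ne_iff.1 hne
  exact Finset.sum_pos' (fun b _ => mul_nonneg (hpos b).le (mul_self_nonneg _))
    ⟨a, Finset.mem_univ a, mul_pos (hpos a) (mul_self_pos.2 ha)⟩

/-- The ratios of the Ricci tensor and the metric on `X 0` and on `X 3` are different. -/
lemma IsLocalParam.not_einstein {g : (Fin 14 → ℝ) → Matrix (Fin 14) (Fin 14) ℝ}
    (hg : ∀ x ∈ V, g x = metricCoeff metricG2 φ x) {x : Fin 14 → ℝ} (hx : x ∈ V) (c : ℝ) :
    ¬ ∀ v w, ricci g x v w = c * (v ⬝ᵥ (g x *ᵥ w)) := by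
  intro hE
  have hu : IsUnit (frameMatrix φ x).det := (h.det_frameMatrix_ne_zero hx).isUnit
  have key : ∀ a : Fin 14, (ricciEigen a / 54 : ℝ) = c * metricEigen a := by
    intro a
    have hv : frameMatrix φ x *ᵥ ((frameMatrix φ x)⁻¹ *ᵥ Pi.single a 1) = Pi.single a 1 := by
      rw [Matrix.mulVec_mulVec, Matrix.mul_nonsing_inv _ hu, Matrix.one_mulVec]
    have := hE ((frameMatrix φ x)⁻¹ *ᵥ Pi.single a 1) ((frameMatrix φ x)⁻¹ *ᵥ Pi.single a 1)
    rw [h.ricci_eq hg hx, hg x hx, h.metricCoeff_eq hx, ← Matrix.mulVec_mulVec,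
      ← Matrix.mulVec_mulVec, Matrix.dotProduct_mulVec, Matrix.vecMul_transpose, hv] at this
    simpa [Pi.single_apply, Matrix.mulVec_diagonal] using this
  have h0 := key 0
  have h3 := key 3
  simp [ricciEigen, metricEigen, eigen] at h0 h3
  linarith

end

/-- The metric of `𝒵(𝕊)` in the coordinates `ψ` is that of `G_2` in the coordinates
`orbitInv ∘ ψ`. -/
lemma metricCoeff_euclid_eq {V : Set (Fin 14 → ℝ)}
    {ψ : (Fin 14 → ℝ) → (Fin 16 → ℝ) × (Fin 16 → ℝ)} (h : IsLocalParam Z V ψ)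
    {x : Fin 14 → ℝ} (hx : x ∈ V) :
    metricCoeff euclid ψ x = metricCoeff metricG2 (orbitInv ∘ ψ) x := by
  have hf : HasFDerivAt ψ (orbitLin.toContinuousLinearMap.comp (fderiv ℝ (orbitInv ∘ ψ) x)) x := by
    refine HasFDerivAt.congr_of_eventuallyEq
      (orbitLin.toContinuousLinearMap.hasFDerivAt.comp x (h.orbitInv.hasFDerivAt hx)) ?_
    exact Filter.eventuallyEq_of_mem (h.isOpen.mem_nhds hx) fun y hy =>
      (orbitMap_orbitInv (h.mapsTo hy)).symm
  ext i j
  rw [metricCoeff, Matrix.of_apply, hf.fderiv]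
  rfl

end ZeroDivisors

/-- `𝒵(𝕊) ⊂ ℝ^32`, with the induced metric, is identified with `G_2` by means of the orbit map of
`(e_4 + e_13, e_6 + e_15)`; the resulting left-invariant metric has positive Ricci curvature, its
Ricci tensor is `5/2 ∑_{i ≤ 2} X^i ⊗ X^i + 29/54 ∑_{3 ≤ i ≤ 5} X^i ⊗ X^i
+ 5/6 ∑_{6 ≤ i ≤ 13} X^i ⊗ X^i`, and it is not Einstein. -/
theorem mainTheorem2 :
    -- the Riemannian manifolds and their identification
    IsSubmanifold 14 G2 ∧ IsSubmanifold 14 Z ∧ IsDiffeo 14 orbitMap G2 Z ∧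
    (∀ A ∈ G2, ∀ P Q, metricG2 (A * P) (A * Q) = metricG2 P Q) ∧
    -- the `X_i` form a `gbi`-orthonormal basis of the Lie algebra, so the `X^i` are the dual basis
    (∀ i j, gbi (X i) (X j) = if i = j then 1 else 0) ∧
    (Submodule.span ℝ (Set.range X) : Set (Matrix (Fin 8) (Fin 8) ℝ)) = g2 ∧
    -- positive Ricci curvature
    HasPositiveRicci 14 Z euclid ∧ HasPositiveRicci 14 G2 metricG2 ∧
    -- the Ricci tensor
    (∀ (V : Set (Fin 14 → ℝ)) (φ : (Fin 14 → ℝ) → Matrix (Fin 8) (Fin 8) ℝ),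
      IsLocalParam G2 V φ → ∀ x ∈ V, ∀ v w : Fin 14 → ℝ,
        ricci (metricCoeff metricG2 φ) x v w =
          5 / 2 * ∑ i ∈ Finset.Icc (0 : Fin 14) 2,
              coframe i (φ x) (fderiv ℝ φ x v) * coframe i (φ x) (fderiv ℝ φ x w)
          + 29 / 54 * ∑ i ∈ Finset.Icc (3 : Fin 14) 5,
              coframe i (φ x) (fderiv ℝ φ x v) * coframe i (φ x) (fderiv ℝ φ x w)
          + 5 / 6 * ∑ i ∈ Finset.Icc (6 : Fin 14) 13,
              coframe i (φ x) (fderiv ℝ φ x v) * coframe i (φ x) (fderiv ℝ φ x w)) ∧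
    -- the metric is not Einstein
    ¬ IsEinstein 14 Z euclid ∧ ¬ IsEinstein 14 G2 metricG2 := by
  refine ⟨isSubmanifold_G2, isSubmanifold_Z, isDiffeo_orbitMap,
    fun A hA P Q => metricG2_mul hA P Q, gbi_X, span_X, ?_, ?_, ?_, ?_, ?_⟩
  · exact fun V ψ h x hx w hw =>
      h.orbitInv.ricci_pos (fun y hy => metricCoeff_euclid_eq h hy) hx hw
  · exact fun V φ h x hx w hw => h.ricci_pos (fun _ _ => rfl) hx hw
  · intro V φ h x hx v w
    rw [h.ricci_eq (fun _ _ => rfl) hx]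
    simp only [frameMatrix_mulVec]
    have h1 : Finset.Icc (0 : Fin 14) 2 = {0, 1, 2} := by decide
    have h2 : Finset.Icc (3 : Fin 14) 5 = {3, 4, 5} := by decide
    have h3 : Finset.Icc (6 : Fin 14) 13 = {6, 7, 8, 9, 10, 11, 12, 13} := by decide
    rw [h1, h2, h3]
    simp [Fin.sum_univ_succ, ricciEigen]
    ring
  · rintro ⟨c, hc⟩
    obtain ⟨p, hp⟩ : Z.Nonempty := ⟨_, orbitMap_mem one_mem_G2⟩
    obtain ⟨V, ψ, h, x, hx, -⟩ := isSubmanifold_Z p hp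
    exact h.orbitInv.not_einstein (fun y hy => metricCoeff_euclid_eq h hy) hx c (hc V ψ h x hx)
  · rintro ⟨c, hc⟩
    obtain ⟨V, φ, h, x, hx, -⟩ := isSubmanifold_G2 1 one_mem_G2
    exact h.not_einstein (fun _ _ => rfl) hx c (hc V φ h x hx)
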